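/- Let $n,d\ge 1$ and $\mathcal A=\mathbb Z[v,v^{-1}]$. For a finite field $\mathbb F_q$ of odd characteristic let $\mathscr X$ be the set of flags $0=V_0\subseteq V_1\subseteq\dots\subseteq V_n=\mathbb F_q^d$. To a pair $(V,V')\in\mathscr X\times\mathscr X$ attach the $n\times n$ matrix with $(i,j)$ entry $\dim\frac{V_{i-1}+V_i\cap V'_j}{V_{i-1}+V_i\cap V'_{j-1}}$; this identifies the $GL(\mathbb F_q^d)$-orbits on $\mathscr X\times\mathscr X$ with the set $\Theta_d$ of $n\times n$ matrices over $\mathbb N$ whose entries sum to $d$. Let $\mathcal S$ be the associative $\mathcal A$-algebra, free as an $\mathcal A$-module with basis $e_A$ $(A\in\Theta_d)$, whose product becomes, for every such $q$, under $v\mapsto\sqrt q$ and with $e_A$ sent to the characteristic function of the orbit of $A$, the convolution $(f*g)(V,V')=\sum_{V''\in\mathscr X}f(V,V'')g(V'',V')$. For $A=(a_{ij})$, $B=(b_{ij})$ in $\Theta_d$ write $A\preceq B$ if $$\sum_{r\le i,\,s\ge j}a_{rs}\le\sum_{r\le i,\,s\ge j}b_{rs}\ \ (i<j),\qquad \sum_{r\ge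 i,\,s\le j}a_{rs}\le\sum_{r\ge i,\,s\le j}b_{rs}\ \ (i>j),$$ and $A\prec B$ if $A\preceq B$ and not $B\preceq A$. Let $E_{ij}$ denote the matrix units. **Theorem.** For every $A=(a_{ij})\in\Theta_d$ there is exactly one family $(D_{ij})_{1\le i\ne j\le n}$ of diagonal matrices with entries in $\mathbb N$ such that $D_{ij}+a_{ij}E_{ij}\in\Theta_d$ for all $i\neq j$ and $$\prod_{1\le j<i\le n}e_{D_{ij}+a_{ij}E_{ij}}*\prod_{1\le i<j\le n}e_{D_{ij}+a_{ij}E_{ij}}=\chi_A e_A+\text{lower terms}$$ in $\mathcal S$ for some $\chi_A\in\mathcal A\setminus\{0\}$, where "lower terms" means an $\mathcal A$-linear combination of elements $e_C$ with $C\in\Theta_d$, $C\prec A$. In the first product the factor of $(i,j)$ stands before (to the left of) that of $(i',j')$ if $j<j'$, or $j=j'$ and $i<i'$; in the second product the factor of $(i,j)$ stands before that of $(i',j')$ if $j>j'$, or $j=j'$ and $i>i'$. -/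

import Mathlib

open scoped LaurentPolynomial

noncomputable section

namespace BLM

/-- The ground ring `𝒜 = ℤ[v, v⁻¹]`. -/
abbrev LaurentA : Type := ℤ[T;T⁻¹]

/-- `n`-step flags `0 = V₀ ⊆ V₁ ⊆ ⋯ ⊆ Vₙ = K^d`. -/
@[ext]
structure Flag (K : Type) [Field K] (n d : ℕ) where
  space : Fin (n + 1) → Submodule K (Fin d → K)
  mono : Monotone space
  first : space 0 = ⊥
  last : space (Fin.last n) = ⊤

instance instFiniteFlag (K : Type) [Field K] [Finite K] (n d : ℕ) : Finite (Flag K n d) := by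
  have : Finite (Submodule K (Fin d → K)) := Finite.of_injective _ SetLike.coe_injective
  exact Finite.of_injective (fun V : Flag K n d => V.space) (fun _ _ h => Flag.ext h)

instance instFintypeFlag (K : Type) [Field K] [Finite K] (n d : ℕ) : Fintype (Flag K n d) :=
  Fintype.ofFinite _

instance instDecidableEqFlag (K : Type) [Field K] (n d : ℕ) : DecidableEq (Flag K n d) :=
  Classical.decEq _

/-- The matrix of a pair of flags: its `(i, j)` entry (`1 ≤ i, j ≤ n`, shifted to `Fin n`) is
`dim (V_{i-1} + V_i ∩ V'_j) / (V_{i-1} + V_i ∩ V'_{j-1})`. Two pairs of flags lie in the same orbit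
of `GL_d(K)` exactly when their matrices agree. -/
def relPos {K : Type} [Field K] {n d : ℕ} (V V' : Flag K n d) : Matrix (Fin n) (Fin n) ℕ :=
  fun i j =>
    Module.finrank K
      (↥(V.space i.castSucc ⊔ V.space i.succ ⊓ V'.space j.succ) ⧸
        (V.space i.castSucc ⊔ V.space i.succ ⊓ V'.space j.castSucc).submoduleOf
          (V.space i.castSucc ⊔ V.space i.succ ⊓ V'.space j.succ))

/-- `Θ_d`: the `n × n` matrices over `ℕ` with sum of entries `d`. -/
def Theta (n d : ℕ) : Set (Matrix (Fin n) (Fin n) ℕ) :=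
  {A | ∑ i, ∑ j, A i j = d}

/-- The finite fields of odd characteristic, one field of each order `q = p ^ r`. -/
structure OddField where
  p : ℕ
  r : ℕ
  prime : Fact p.Prime
  odd : Odd p
  pos : r ≠ 0

instance instFactPrime (κ : OddField) : Fact κ.p.Prime := κ.prime

/-- The field with `q = p ^ r` elements. -/
abbrev OddField.K (κ : OddField) : Type := GaloisField κ.p κ.r

/-- The element `√q` of `ℝˣ`. -/
def OddField.sqrtQ (κ : OddField) : ℝˣ :=
  Units.mk0 (Real.sqrt ((κ.p : ℝ) ^ κ.r))
    (Real.sqrt_ne_zero'.mpr (pow_pos (Nat.cast_pos.mpr κ.prime.out.pos) _))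

/-- Specialization `v ↦ √q`. -/
def OddField.spec (κ : OddField) : LaurentA →+* ℝ :=
  LaurentPolynomial.eval₂ (Int.castRingHom ℝ) κ.sqrtQ

/-- Families, indexed by the finite fields of odd characteristic, of real functions on the set of
pairs of flags. For each field the product is the matrix product, that is the convolution
`(f * g)(V, V') = ∑ V'', f (V, V'') * g (V'', V')`. -/
def ConvFamily (n d : ℕ) : Type :=
  (κ : OddField) → Matrix (Flag κ.K n d) (Flag κ.K n d) ℝ

instance instRingConvFamily (n d : ℕ) : Ring (ConvFamily n d) :=
  inferInstanceAs (Ring ((κ : OddField) → Matrix (Flag κ.K n d) (Flag κ.K n d) ℝ))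

/-- A Laurent polynomial, seen as the family of scalars obtained from `v ↦ √q`. -/
def scalarHom (n d : ℕ) : LaurentA →+* ConvFamily n d :=
  RingHom.pi fun κ => (Matrix.scalar (Flag κ.K n d)).comp κ.spec

/-- `v` acts on the component at the field with `q` elements as `√q`. -/
instance instAlgebraConvFamily (n d : ℕ) : Algebra LaurentA (ConvFamily n d) :=
  (scalarHom n d).toAlgebra' fun c x => by
    funext κ
    exact Matrix.scalar_commute (κ.spec c) (fun r => mul_comm _ r) (x κ)

open Classical in
/-- The characteristic function of the orbit with matrix `M`, over all fields at once
(it is zero when `M ∉ Θ_d`). -/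
def orbitFun (n d : ℕ) (M : Matrix (Fin n) (Fin n) ℕ) : ConvFamily n d :=
  fun _ => Matrix.of fun V V' => if relPos V V' = M then 1 else 0

/-- The generic convolution algebra `𝒮` over `𝒜 = ℤ[v, v⁻¹]`. Its product is the one that becomes
the convolution product over the field with `q` elements when `v` is specialized to `√q`, for all
`q`. It is realized inside the product of all these specializations, where it is generated by the
characteristic functions `e_M` of the orbits. -/
def schurAlgebra (n d : ℕ) : Subalgebra LaurentA (ConvFamily n d) :=
  Algebra.adjoin LaurentA (Set.range (orbitFun n d))

/-- The element `e_M` of `𝒮`. -/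
def e (n d : ℕ) (M : Matrix (Fin n) (Fin n) ℕ) : schurAlgebra n d :=
  ⟨orbitFun n d M, Algebra.subset_adjoin (Set.mem_range_self M)⟩

/-- The relation `A ≼ B`. -/
def Preceq {n : ℕ} (A B : Matrix (Fin n) (Fin n) ℕ) : Prop :=
  (∀ i j : Fin n, i < j →
    ∑ r ∈ Finset.Iic i, ∑ s ∈ Finset.Ici j, A r s ≤
      ∑ r ∈ Finset.Iic i, ∑ s ∈ Finset.Ici j, B r s) ∧
  (∀ i j : Fin n, j < i →
    ∑ r ∈ Finset.Ici i, ∑ s ∈ Finset.Iic j, A r s ≤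
      ∑ r ∈ Finset.Ici i, ∑ s ∈ Finset.Iic j, B r s)

/-- The strict relation of `≼`. -/
def Prec {n : ℕ} (A B : Matrix (Fin n) (Fin n) ℕ) : Prop :=
  Preceq A B ∧ ¬ Preceq B A

/-- Off-diagonal positions `(i, j)`. -/
abbrev OffDiag (n : ℕ) : Type := {p : Fin n × Fin n // p.1 ≠ p.2}

/-- The positions `(i, j)` with `j < i`; `(i, j)` comes before `(i', j')` if `j < j'`, or `j = j'`
and `i < i'`. -/
def lowerList (n : ℕ) : List (OffDiag n) :=
  (List.finRange n).flatMap fun j =>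
    (List.finRange n).filterMap fun i =>
      if h : j < i then some ⟨(i, j), h.ne'⟩ else none

/-- The positions `(i, j)` with `i < j`; `(i, j)` comes before `(i', j')` if `j > j'`, or `j = j'`
and `i > i'`. -/
def upperList (n : ℕ) : List (OffDiag n) :=
  (List.finRange n).reverse.flatMap fun j =>
    (List.finRange n).reverse.filterMap fun i =>
      if h : i < j then some ⟨(i, j), h.ne⟩ else none

/-- The matrix `D + a_{ij} E_{ij}`, where `D` is the diagonal matrix with the given entries and
`p = (i, j)`. -/
def elemMatrix {n : ℕ} (A : Matrix (Fin n) (Fin n) ℕ) (D : Fin n → ℕ) (p : OffDiag n) :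
    Matrix (Fin n) (Fin n) ℕ :=
  Matrix.diagonal D + Matrix.single p.1.1 p.1.2 (A p.1.1 p.1.2)

end BLM

end

/-!
Fix a basis of `K^d` indexed by the units of the entries of `A`, a unit over `(i, j)` being labelled
`i`. Moving the labels of the units over `(i, j)` from `i` to `j`, for one position after another in
the order of the product, gives a gallery of coordinate flags whose steps have relative positions
`D_{ij} + a_{ij} E_{ij}` and whose end points have relative position `A`. This defines `D`.

As characteristic functions are nonnegative, the product is nonzero at a pair of flags exactly when
a gallery of this type joins the pair. Along such a gallery `V` and `V'`, each lower step enlarges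
and each upper step shrinks the flag, and counting dimensions one step at a time gives
`relPos V V' ≼ A`. The first flag of a gallery has the dimensions prescribed by the first step, so
`relPos V V'` has the row sums of `A`; on matrices with the same row sums `≼` is antisymmetric,
which gives the leading term `A`. Conversely, if another `D'` has leading term `A`, the product
for `D'` is nonzero at the pair constructed above; each elementary step determines the dimensions
of its right-hand flag from those of the left-hand one, so going along the two galleries from the
same first flag one finds `D' = D`.

The coefficients of the product are Laurent polynomials for the following reason. Summing a family
whose values are polynomials in `q` over the flags obtained by adding a vector gives another such
family, and the characteristic function of an elementary position `D + (a + 1) E_{ij}` arises in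
this way from `D + a E_{ij}` up to a factor `q^(m + a + 1) - q^m`. This factor is
monic in `q` and its values divide those of the sum for infinitely many `q`, hence it divides the
sum in `ℤ[q]`.
-/

noncomputable section

namespace BLM

open Module

/-! ### Corner sums and relative positions -/

section Corner

variable {m n : ℕ} {M : Type*}

theorem sum_castSucc_lt_succ [AddCommMonoid M] (f : Fin n → M) (i : Fin n) :
    ∑ r with r.castSucc < i.succ, f r = ∑ r with r.castSucc < i.castSucc, f r + f i := by
  have hfilter : (Finset.univ.filter fun r : Fin n => r.castSucc < i.succ) = Finset.Iic i := by
    ext r; simp [Fin.castSucc_lt_succ_iff]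
  have hfilter' : (Finset.univ.filter fun r : Fin n => r.castSucc < i.castSucc) =
      Finset.Iio i := by
    ext r; simp
  rw [hfilter, hfilter', Finset.sum_Iio_add_eq_sum_Iic]

/-- The sum of the entries of `C` in its first `k` rows and first `l` columns. The relative
position of two flags is determined by these sums, which are the dimensions of the intersections
`V_k ∩ V'_l`. -/
def corner [AddCommMonoid M] (C : Matrix (Fin m) (Fin n) M) (k : Fin (m + 1)) (l : Fin (n + 1)) :
    M :=
  ∑ i with i.castSucc < k, ∑ j with j.castSucc < l, C i j

section AddCommMonoid

variable [AddCommMonoid M] (C : Matrix (Fin m) (Fin n) M)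

theorem corner_zero_left (l : Fin (n + 1)) : corner C 0 l = 0 := by
  simp [corner]

theorem corner_zero_right (k : Fin (m + 1)) : corner C k 0 = 0 := by
  simp [corner]

theorem corner_succ_succ (i : Fin m) (j : Fin n) :
    corner C i.succ j.succ + corner C i.castSucc j.castSucc =
      corner C i.succ j.castSucc + corner C i.castSucc j.succ + C i j := by
  simp only [corner, sum_castSucc_lt_succ, Finset.sum_add_distrib]
  abel

theorem corner_transpose (k : Fin (n + 1)) (l : Fin (m + 1)) :
    corner C.transpose k l = corner C l k := by
  simp only [corner, Matrix.transpose_apply]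
  exact Finset.sum_comm

theorem corner_last_last : corner C (Fin.last m) (Fin.last n) = ∑ i, ∑ j, C i j := by
  simp [corner, Fin.castSucc_lt_last]

end AddCommMonoid

theorem eq_corner_of_succ_succ [AddCancelCommMonoid M] (C : Matrix (Fin m) (Fin n) M)
    (r : Fin (m + 1) → Fin (n + 1) → M) (hleft : ∀ l, r 0 l = 0) (hright : ∀ k, r k 0 = 0)
    (hsucc : ∀ i j, r i.succ j.succ + r i.castSucc j.castSucc =
      r i.succ j.castSucc + r i.castSucc j.succ + C i j) :
    r = corner C := by
  ext k l
  induction k using Fin.induction generalizing l with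
  | zero => rw [hleft, corner_zero_left]
  | succ i ihi =>
    induction l using Fin.induction with
    | zero => rw [hright, corner_zero_right]
    | succ j ihj =>
      refine add_right_cancel (b := r i.castSucc j.castSucc) ?_
      rw [hsucc, ihj, ihi, ihi, corner_succ_succ]

/-- The matrix of second differences, the left inverse of `corner`. The subtraction of natural
numbers is harmless because the function is only applied to arrays of corner sums. -/
def secondDiff (r : Fin (m + 1) → Fin (n + 1) → ℕ) : Matrix (Fin m) (Fin n) ℕ :=
  Matrix.of fun i j =>
    r i.succ j.succ + r i.castSucc j.castSucc - (r i.succ j.castSucc + r i.castSucc j.succ)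

theorem secondDiff_corner (C : Matrix (Fin m) (Fin n) ℕ) : secondDiff (corner C) = C := by
  ext i j
  rw [secondDiff, Matrix.of_apply, corner_succ_succ, Nat.add_sub_cancel_left]

variable {ι : Type*} [Fintype ι]

/-- The matrix whose `(i, j)` entry counts the elements with labels `i` and `j`. -/
def countMatrix (f : ι → Fin m) (g : ι → Fin n) : Matrix (Fin m) (Fin n) ℕ :=
  Matrix.of fun i j => (Finset.univ.filter fun x => f x = i ∧ g x = j).card

theorem countMatrix_apply (f : ι → Fin m) (g : ι → Fin n) (i : Fin m) (j : Fin n) :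
    countMatrix f g i j = (Finset.univ.filter fun x => f x = i ∧ g x = j).card :=
  rfl

theorem countMatrix_eq_zero_iff {f : ι → Fin m} {g : ι → Fin n} {i : Fin m} {j : Fin n} :
    countMatrix f g i j = 0 ↔ ∀ x, f x = i → g x ≠ j := by
  simp [countMatrix_apply, Finset.filter_eq_empty_iff]

theorem corner_countMatrix (f : ι → Fin m) (g : ι → Fin n) (k : Fin (m + 1)) (l : Fin (n + 1)) :
    corner (countMatrix f g) k l =
      (Finset.univ.filter fun x => (f x).castSucc < k ∧ (g x).castSucc < l).card := by
  rw [Finset.card_eq_sum_card_fiberwise (f := fun x => (f x, g x))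
    (t := (Finset.univ.filter fun i : Fin m => i.castSucc < k) ×ˢ
      (Finset.univ.filter fun j : Fin n => j.castSucc < l)) fun x hx => by simpa using hx,
    Finset.sum_product]
  refine Finset.sum_congr rfl fun i hi => Finset.sum_congr rfl fun j hj => ?_
  rw [countMatrix_apply]
  congr 1
  ext x
  simp only [Finset.mem_filter, Finset.mem_univ, true_and, Prod.mk.injEq] at hi hj ⊢
  exact (and_iff_right_of_imp fun h => ⟨h.1 ▸ hi, h.2 ▸ hj⟩).symm

/-- The units of a matrix over `ℕ`: the entry `C i j` stands for `C i j` elements over `(i, j)`. -/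
abbrev Cells (C : Matrix (Fin m) (Fin n) ℕ) : Type :=
  Σ p : Fin m × Fin n, Fin (C p.1 p.2)

theorem card_cells (C : Matrix (Fin m) (Fin n) ℕ) :
    Fintype.card (Cells C) = ∑ i, ∑ j, C i j := by
  simp [Fintype.card_sigma, Fintype.sum_prod_type]

theorem countMatrix_cells (C : Matrix (Fin m) (Fin n) ℕ) :
    countMatrix (fun x : Cells C => x.1.1) (fun x => x.1.2) = C := by
  ext i j
  rw [countMatrix_apply, ← Fintype.card_subtype]
  refine (Fintype.card_congr ?_).trans (Fintype.card_fin (C i j))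
  refine ⟨fun x => Fin.cast (by rw [x.2.1, x.2.2]) x.1.2, fun t => ⟨⟨(i, j), t⟩, rfl, rfl⟩, ?_,
    fun _ => rfl⟩
  rintro ⟨⟨⟨r, s⟩, t⟩, rfl, rfl⟩
  rfl

end Corner

section RelPos

variable {K : Type} [Field K] {n d : ℕ}

/-- The dimension of `V_k ∩ V'_l`. -/
def meetDim (V V' : Flag K n d) (k l : Fin (n + 1)) : ℕ :=
  finrank K ↥(V.space k ⊓ V'.space l)

theorem meetDim_comm (V V' : Flag K n d) (k l : Fin (n + 1)) :
    meetDim V V' k l = meetDim V' V l k := by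
  rw [meetDim, meetDim, inf_comm]

theorem meetDim_last_right (V V' : Flag K n d) (k : Fin (n + 1)) :
    meetDim V V' k (Fin.last n) = finrank K (V.space k) := by
  rw [meetDim, V'.last, inf_top_eq]

theorem Flag.castSucc_le_succ (V : Flag K n d) (i : Fin n) :
    V.space i.castSucc ≤ V.space i.succ :=
  V.mono Fin.castSucc_lt_succ.le

theorem finrank_sup_inf_add_meetDim (V V' : Flag K n d) (i : Fin n) (l : Fin (n + 1)) :
    finrank K ↥(V.space i.castSucc ⊔ V.space i.succ ⊓ V'.space l) + meetDim V V' i.castSucc l =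
      finrank K (V.space i.castSucc) + meetDim V V' i.succ l := by
  have h := Submodule.finrank_sup_add_finrank_inf_eq (V.space i.castSucc)
    (V.space i.succ ⊓ V'.space l)
  rwa [← inf_assoc, inf_eq_left.mpr (V.castSucc_le_succ i)] at h

theorem meetDim_succ_succ (V V' : Flag K n d) (i j : Fin n) :
    meetDim V V' i.succ j.succ + meetDim V V' i.castSucc j.castSucc =
      meetDim V V' i.succ j.castSucc + meetDim V V' i.castSucc j.succ + relPos V V' i j := by
  have hle : V.space i.castSucc ⊔ V.space i.succ ⊓ V'.space j.castSucc ≤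
      V.space i.castSucc ⊔ V.space i.succ ⊓ V'.space j.succ :=
    sup_le_sup le_rfl (inf_le_inf le_rfl (V'.castSucc_le_succ j))
  have hquot : relPos V V' i j +
      finrank K ↥(V.space i.castSucc ⊔ V.space i.succ ⊓ V'.space j.castSucc) =
        finrank K ↥(V.space i.castSucc ⊔ V.space i.succ ⊓ V'.space j.succ) := by
    rw [relPos, ← (Submodule.submoduleOfEquivOfLe hle).finrank_eq,
      Submodule.finrank_quotient_add_finrank]
  have hsucc := finrank_sup_inf_add_meetDim V V' i j.succ
  have hcastSucc := finrank_sup_inf_add_meetDim V V' i j.castSucc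
  lia

theorem meetDim_eq_corner (V V' : Flag K n d) : meetDim V V' = corner (relPos V V') :=
  eq_corner_of_succ_succ _ _ (fun l => by simp [meetDim, V.first])
    (fun k => by simp [meetDim, V'.first]) (meetDim_succ_succ V V')

theorem relPos_eq_secondDiff (V V' : Flag K n d) : relPos V V' = secondDiff (meetDim V V') := by
  rw [meetDim_eq_corner, secondDiff_corner]

theorem relPos_eq_iff {V V' : Flag K n d} {C : Matrix (Fin n) (Fin n) ℕ} :
    relPos V V' = C ↔ ∀ k l, meetDim V V' k l = corner C k l := by
  refine ⟨?_, fun h => ?_⟩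
  · rintro rfl k l
    rw [meetDim_eq_corner]
  · rw [relPos_eq_secondDiff, funext₂ h, secondDiff_corner]

theorem relPos_swap (V V' : Flag K n d) : relPos V' V = (relPos V V').transpose := by
  rw [relPos_eq_iff]
  intro k l
  rw [corner_transpose, ← meetDim_eq_corner, meetDim_comm]

theorem finrank_left (V V' : Flag K n d) (k : Fin (n + 1)) :
    finrank K (V.space k) = corner (relPos V V') k (Fin.last n) := by
  rw [← meetDim_eq_corner, meetDim_last_right]

theorem finrank_right (V V' : Flag K n d) (k : Fin (n + 1)) :
    finrank K (V'.space k) = corner (relPos V V') (Fin.last n) k := by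
  rw [← meetDim_eq_corner, meetDim_comm, meetDim_last_right]

theorem relPos_mem_Theta (V V' : Flag K n d) : relPos V V' ∈ Theta n d := by
  change _ = _
  rw [← corner_last_last, ← finrank_left, V.last, finrank_top, finrank_fin_fun]

end RelPos

/-! ### Adapted bases -/

section SpanImage

variable {ι R M : Type*} [Semiring R] [AddCommMonoid M] [Module R M]

theorem span_image_inter (b : Basis ι R M) (s t : Set ι) :
    Submodule.span R (b '' (s ∩ t)) = Submodule.span R (b '' s) ⊓ Submodule.span R (b '' t) := by
  ext v
  rw [Submodule.mem_inf, b.mem_span_image, b.mem_span_image, b.mem_span_image, Set.subset_inter_iff]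

theorem span_image_le_span_image_iff [Nontrivial R] (b : Basis ι R M) {s t : Set ι} :
    Submodule.span R (b '' s) ≤ Submodule.span R (b '' t) ↔ s ⊆ t := by
  rw [Submodule.span_le, Set.image_subset_iff]
  exact forall₂_congr fun x _ => b.self_mem_span_image

theorem span_image_injective [Nontrivial R] (b : Basis ι R M) :
    Function.Injective fun s : Set ι => Submodule.span R (b '' s) := fun _ _ h =>
  Set.Subset.antisymm ((span_image_le_span_image_iff b).mp h.le)
    ((span_image_le_span_image_iff b).mp h.ge)

theorem finrank_span_image {R M : Type*} [Ring R] [StrongRankCondition R] [AddCommGroup M]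
    [Module R M] (b : Basis ι R M) (s : Finset ι) :
    finrank R (Submodule.span R (b '' s)) = s.card := by
  classical
  have := nontrivial_of_invariantBasisNumber R
  rw [← Finset.coe_image, finrank_span_finset_eq_card, Finset.card_image_of_injective _ b.injective]
  rw [Finset.coe_image]
  exact b.linearIndependent.linearIndepOn_id.mono (Set.image_subset_range b s)

end SpanImage

section Adapted

variable {K : Type} [Field K] {n d : ℕ} {ι : Type*}

/-- A flag is adapted to a basis with labels `f` if `V_k` is spanned by the basis vectors with
label below `k`. Two flags have a common adapted basis, and their relative position counts the
pairs of labels. -/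
def IsAdapted (V : Flag K n d) (b : Basis ι K (Fin d → K)) (f : ι → Fin n) : Prop :=
  ∀ k, V.space k = Submodule.span K (b '' {x | (f x).castSucc < k})

theorem isAdapted_of_le_span {V : Flag K n d} {b : Basis ι K (Fin d → K)} {f : ι → Fin n}
    (hmem : ∀ x, b x ∈ V.space (f x).succ)
    (hle : ∀ k, V.space k ≤ Submodule.span K (b '' {x | (f x).castSucc < k})) :
    IsAdapted V b f := by
  refine fun k => (hle k).antisymm (Submodule.span_le.mpr ?_)
  rintro _ ⟨x, hx, rfl⟩
  exact V.mono (Fin.castSucc_lt_iff_succ_le.mp hx) (hmem x)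

theorem exists_sup_span_eq {K E : Type*} [DivisionRing K] [AddCommGroup E] [Module K E]
    [FiniteDimensional K E] {S R : Submodule K E} (h : R ≤ S) {c : ℕ}
    (hc : finrank K S = finrank K R + c) :
    ∃ w : Fin c → E, S = R ⊔ Submodule.span K (Set.range w) := by
  obtain ⟨W, hW⟩ := Submodule.exists_isCompl R
  have hsup : R ⊔ W ⊓ S = S := by
    rw [← sup_inf_assoc_of_le W h, hW.sup_eq_top, top_inf_eq]
  have hinf : R ⊓ (W ⊓ S) = ⊥ := by
    rw [← inf_assoc, hW.inf_eq_bot, bot_inf_eq]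
  have hdim := Submodule.finrank_sup_add_finrank_inf_eq R (W ⊓ S)
  rw [hsup, hinf, finrank_bot] at hdim
  let b := finBasisOfFinrankEq K ↥(W ⊓ S) (n := c) (by lia)
  refine ⟨(W ⊓ S).subtype ∘ b, ?_⟩
  rw [Set.range_comp, ← Submodule.map_span, b.span_eq, Submodule.map_top, Submodule.range_subtype,
    hsup]

theorem exists_cells_inf_eq_sup_span (V V' : Flag K n d) :
    ∃ u : Cells (relPos V V') → (Fin d → K), ∀ i j, V.space i.succ ⊓ V'.space j.succ =
      (V.space i.castSucc ⊓ V'.space j.succ ⊔ V.space i.succ ⊓ V'.space j.castSucc) ⊔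
        Submodule.span K (Set.range fun t => u ⟨(i, j), t⟩) := by
  have hstep : ∀ i j, ∃ w : Fin (relPos V V' i j) → (Fin d → K),
      V.space i.succ ⊓ V'.space j.succ =
        (V.space i.castSucc ⊓ V'.space j.succ ⊔ V.space i.succ ⊓ V'.space j.castSucc) ⊔
          Submodule.span K (Set.range w) := by
    refine fun i j => exists_sup_span_eq (sup_le (inf_le_inf (V.castSucc_le_succ i) le_rfl)
      (inf_le_inf le_rfl (V'.castSucc_le_succ j))) ?_
    have hsup := Submodule.finrank_sup_add_finrank_inf_eq
      (V.space i.castSucc ⊓ V'.space j.succ) (V.space i.succ ⊓ V'.space j.castSucc)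
    rw [inf_inf_inf_comm, inf_eq_left.mpr (V.castSucc_le_succ i),
      inf_eq_right.mpr (V'.castSucc_le_succ j)] at hsup
    have hsucc := meetDim_succ_succ V V' i j
    simp only [meetDim] at hsucc
    lia
  choose w hw using hstep
  exact ⟨fun x => w x.1.1 x.1.2 x.2, hw⟩

theorem inf_le_span_image {V V' : Flag K n d} {f g : ι → Fin n} {u : ι → (Fin d → K)}
    (hu : ∀ i j, V.space i.succ ⊓ V'.space j.succ ≤
      (V.space i.castSucc ⊓ V'.space j.succ ⊔ V.space i.succ ⊓ V'.space j.castSucc) ⊔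
        Submodule.span K (u '' {x | f x = i ∧ g x = j})) (k l : Fin (n + 1)) :
    V.space k ⊓ V'.space l ≤
      Submodule.span K (u '' {x | (f x).castSucc < k ∧ (g x).castSucc < l}) := by
  induction k using Fin.induction generalizing l with
  | zero => simp [V.first]
  | succ i ihi =>
    induction l using Fin.induction with
    | zero => simp [V'.first]
    | succ j ihj =>
      refine (hu i j).trans (sup_le (sup_le ((ihi j.succ).trans ?_) (ihj.trans ?_)) ?_) <;>
        refine Submodule.span_mono (Set.image_mono ?_)
      · exact fun x hx => ⟨hx.1.trans Fin.castSucc_lt_succ, hx.2⟩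
      · exact fun x hx => ⟨hx.1, hx.2.trans Fin.castSucc_lt_succ⟩
      · rintro x ⟨rfl, rfl⟩
        exact ⟨Fin.castSucc_lt_succ, Fin.castSucc_lt_succ⟩

theorem exists_adapted_basis (V V' : Flag K n d) :
    ∃ b : Basis (Cells (relPos V V')) K (Fin d → K),
      IsAdapted V b (fun x => x.1.1) ∧ IsAdapted V' b (fun x => x.1.2) := by
  obtain ⟨u, hu⟩ := exists_cells_inf_eq_sup_span V V'
  have hmem : ∀ x, u x ∈ V.space x.1.1.succ ⊓ V'.space x.1.2.succ := by
    rintro ⟨⟨i, j⟩, t⟩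
    rw [hu]
    exact Submodule.mem_sup_right (Submodule.subset_span ⟨t, rfl⟩)
  have hspan := inf_le_span_image (V := V) (V' := V') (f := fun x : Cells (relPos V V') => x.1.1)
    (g := fun x => x.1.2) (u := u) fun i j => (hu i j).trans_le <| sup_le_sup le_rfl <|
      Submodule.span_mono <| Set.range_subset_iff.mpr fun t => ⟨_, ⟨rfl, rfl⟩, rfl⟩
  have hleft : ∀ k, V.space k ≤ Submodule.span K (u '' {x | x.1.1.castSucc < k}) := fun k => by
    simpa [V'.last, Fin.castSucc_lt_last] using hspan k (Fin.last n)
  have hright : ∀ k, V'.space k ≤ Submodule.span K (u '' {x | x.1.2.castSucc < k}) := fun k => by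
    simpa [V.last, Fin.castSucc_lt_last] using hspan (Fin.last n) k
  have htop : ⊤ ≤ Submodule.span K (Set.range u) :=
    V.last.ge.trans ((hleft _).trans (Submodule.span_mono (Set.image_subset_range _ _)))
  have hcard : Fintype.card (Cells (relPos V V')) = finrank K (Fin d → K) := by
    rw [card_cells, finrank_fin_fun]
    exact relPos_mem_Theta V V'
  have hb := coe_basisOfTopLeSpanOfCardEqFinrank u htop hcard
  refine ⟨basisOfTopLeSpanOfCardEqFinrank u htop hcard, isAdapted_of_le_span ?_ ?_,
    isAdapted_of_le_span ?_ ?_⟩ <;> rw [hb]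
  exacts [fun x => (hmem x).1, hleft, fun x => (hmem x).2, hright]

/-- The flag spanned by the basis vectors with labels below `k`. -/
def coordFlag (b : Basis ι K (Fin d → K)) (f : ι → Fin n) : Flag K n d where
  space k := Submodule.span K (b '' {x | (f x).castSucc < k})
  mono := fun _ _ hkl => Submodule.span_mono (Set.image_mono fun _ hx => lt_of_lt_of_le hx hkl)
  first := by simp
  last := by simp [Fin.castSucc_lt_last, b.span_eq]

theorem isAdapted_coordFlag (b : Basis ι K (Fin d → K)) (f : ι → Fin n) :
    IsAdapted (coordFlag b f) b f :=
  fun _ => rfl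

variable {V V' : Flag K n d} {b : Basis ι K (Fin d → K)} {f g : ι → Fin n}

theorem IsAdapted.relPos_eq [Fintype ι] (hV : IsAdapted V b f) (hV' : IsAdapted V' b g) :
    relPos V V' = countMatrix f g := by
  rw [relPos_eq_iff]
  intro k l
  rw [meetDim, hV k, hV' l, ← span_image_inter, corner_countMatrix, ← finrank_span_image b,
    Finset.coe_filter_univ]
  rfl

theorem IsAdapted.sup_eq (hV : IsAdapted V b f) (hV' : IsAdapted V' b g) (k l : Fin (n + 1)) :
    V.space k ⊔ V'.space l =
      Submodule.span K (b '' {x | (f x).castSucc < k ∨ (g x).castSucc < l}) := by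
  rw [hV k, hV' l, ← Submodule.span_union, ← Set.image_union]
  rfl

theorem relPos_coordFlag [Fintype ι] (b : Basis ι K (Fin d → K)) (f g : ι → Fin n) :
    relPos (coordFlag b f) (coordFlag b g) = countMatrix f g :=
  (isAdapted_coordFlag b f).relPos_eq (isAdapted_coordFlag b g)

theorem nonempty_basis_cells (K : Type) [Field K] {C : Matrix (Fin n) (Fin n) ℕ}
    (hC : C ∈ Theta n d) : Nonempty (Basis (Cells C) K (Fin d → K)) := by
  have hcard : Fintype.card (Fin d) = Fintype.card (Cells C) := by
    rw [card_cells, Fintype.card_fin]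
    exact hC.symm
  exact ⟨(Pi.basisFun K (Fin d)).reindex (Fintype.equivOfCardEq hcard)⟩

theorem exists_relPos_eq (K : Type) [Field K] {C : Matrix (Fin n) (Fin n) ℕ} (hC : C ∈ Theta n d) :
    ∃ V V' : Flag K n d, relPos V V' = C := by
  obtain ⟨b⟩ := nonempty_basis_cells K hC
  exact ⟨_, _, (relPos_coordFlag b _ _).trans (countMatrix_cells C)⟩

end Adapted

/-! ### Adding a vector to the spaces of a flag -/

section AddVec

variable {K : Type} [Field K] {n d : ℕ}

open Classical in
theorem finrank_inf_sup_span_singleton {K E : Type*} [DivisionRing K] [AddCommGroup E]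
    [Module K E] [FiniteDimensional K E] (U : Submodule K E) {W : Submodule K E} {y : E}
    (hy : y ∉ W) :
    finrank K ↥(U ⊓ (W ⊔ Submodule.span K {y})) =
      finrank K ↥(U ⊓ W) + if y ∈ U ⊔ W then 1 else 0 := by
  have hspan := Submodule.finrank_sup_add_finrank_inf_eq U (W ⊔ Submodule.span K {y})
  have hW := Submodule.finrank_sup_add_finrank_inf_eq U W
  rw [Submodule.finrank_sup_span_singleton hy, ← sup_assoc] at hspan
  split_ifs with h
  · rw [sup_eq_left.mpr ((Submodule.span_singleton_le_iff_mem _ _).mpr h)] at hspan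
    lia
  · rw [Submodule.finrank_sup_span_singleton h] at hspan
    lia

/-- The flag obtained from `V` by adding a vector `y` of the `(j + 1)`-st space to the spaces
`V_k` with `i < k ≤ j`. Intersecting with that space makes this a flag for every `y`. -/
def Flag.addVec (V : Flag K n d) (i j : Fin n) (y : Fin d → K) : Flag K n d where
  space k := if k ∈ Set.Ioc i.castSucc j.castSucc then
    V.space k ⊔ Submodule.span K {y} ⊓ V.space j.succ else V.space k
  mono := by
    intro k l hkl
    have h := V.mono hkl
    by_cases hk : k ∈ Set.Ioc i.castSucc j.castSucc
    · by_cases hl : l ∈ Set.Ioc i.castSucc j.castSucc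
      · simp only [if_pos hk, if_pos hl]
        exact sup_le_sup h le_rfl
      · simp only [if_pos hk, if_neg hl]
        have hjl : j.castSucc < l := not_le.mp fun h' => hl ⟨hk.1.trans_le hkl, h'⟩
        exact sup_le h (inf_le_right.trans (V.mono (Fin.castSucc_lt_iff_succ_le.mp hjl)))
    · simp only [if_neg hk]
      split_ifs
      · exact h.trans le_sup_left
      · exact h
  first := by
    rw [if_neg fun h => Fin.not_lt_zero _ h.1]
    exact V.first
  last := by
    rw [if_neg fun h => h.2.not_gt (Fin.castSucc_lt_last j)]
    exact V.last

variable {V V' : Flag K n d} {i j : Fin n} {y : Fin d → K} {k : Fin (n + 1)}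

theorem Flag.addVec_space_of_mem (hy : y ∈ V.space j.succ)
    (hk : k ∈ Set.Ioc i.castSucc j.castSucc) :
    (V.addVec i j y).space k = V.space k ⊔ Submodule.span K {y} := by
  change (if _ then _ else _) = _
  rw [if_pos hk, inf_eq_left.mpr ((Submodule.span_singleton_le_iff_mem _ _).mpr hy)]

theorem Flag.addVec_space_of_notMem (hk : k ∉ Set.Ioc i.castSucc j.castSucc) :
    (V.addVec i j y).space k = V.space k :=
  if_neg hk

theorem Flag.le_addVec (V : Flag K n d) (i j : Fin n) (y : Fin d → K) (k : Fin (n + 1)) :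
    V.space k ≤ (V.addVec i j y).space k := by
  change _ ≤ if _ then _ else _
  split_ifs
  exacts [le_sup_left, le_rfl]

open Classical in
theorem meetDim_addVec (V : Flag K n d) (hy : y ∈ V'.space j.succ) (hy' : y ∉ V'.space j.castSucc)
    (k l : Fin (n + 1)) :
    meetDim V (V'.addVec i j y) k l = meetDim V V' k l +
      if l ∈ Set.Ioc i.castSucc j.castSucc ∧ y ∈ V.space k ⊔ V'.space l then 1 else 0 := by
  by_cases h : l ∈ Set.Ioc i.castSucc j.castSucc
  · rw [meetDim, Flag.addVec_space_of_mem hy h,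
      finrank_inf_sup_span_singleton _ fun hm => hy' (V'.mono h.2 hm), meetDim]
    simp only [h, true_and]
  · rw [meetDim, Flag.addVec_space_of_notMem h, meetDim, if_neg fun hh => h hh.1, add_zero]

variable {ι : Type*}

/-- The relative position of `V` and `V'.addVec i j y`, where `V` and `V'` are adapted to a basis
with labels `f` and `g`, and `y` has support `Z`. -/
def shiftMatrix [Fintype ι] (f g : ι → Fin n) (i j : Fin n) (Z : Finset ι) :
    Matrix (Fin n) (Fin n) ℕ :=
  secondDiff fun k l => corner (countMatrix f g) k l +
    if l ∈ Set.Ioc i.castSucc j.castSucc ∧ ∀ x ∈ Z, (f x).castSucc < k ∨ (g x).castSucc < l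
      then 1 else 0

theorem IsAdapted.relPos_addVec [Fintype ι] {b : Basis ι K (Fin d → K)} {f g : ι → Fin n}
    (hV : IsAdapted V b f) (hV' : IsAdapted V' b g)
    (hy : y ∈ V'.space j.succ) (hy' : y ∉ V'.space j.castSucc) :
    relPos V (V'.addVec i j y) = shiftMatrix f g i j (b.repr y).support := by
  classical
  rw [relPos_eq_secondDiff, shiftMatrix]
  congr 1
  ext k l
  rw [meetDim_addVec V hy hy', meetDim_eq_corner, hV.relPos_eq hV', hV.sup_eq hV',
    b.mem_span_image]
  congr

theorem IsAdapted.mem_sdiff_iff {b : Basis ι K (Fin d → K)} {f : ι → Fin n}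
    (hV : IsAdapted V b f) :
    y ∈ V.space j.succ ∧ y ∉ V.space j.castSucc ↔ IsGreatest (f '' (b.repr y).support) j := by
  rw [hV, hV, b.mem_span_image, b.mem_span_image]
  simp only [Set.subset_def, Set.mem_ofPred_eq, Fin.castSucc_lt_succ_iff,
    Fin.castSucc_lt_castSucc_iff, not_forall, not_lt, IsGreatest, upperBounds, Set.mem_image,
    forall_exists_index, and_imp, forall_apply_eq_imp_iff₂]
  constructor
  · rintro ⟨hle, x, hx, hjx⟩
    exact ⟨⟨x, hx, (hle x hx).antisymm hjx⟩, hle⟩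
  · rintro ⟨⟨x, hx, rfl⟩, hle⟩
    exact ⟨hle, x, hx, le_rfl⟩

open Classical in
theorem card_filter_support_eq {R : Type*} [Zero R] [Fintype R] [Fintype ι] (Z : Finset ι) :
    (Finset.univ.filter fun y : ι → R => (Finset.univ.filter fun x => y x ≠ 0) = Z).card =
      (Fintype.card R - 1) ^ Z.card := by
  have h : (Finset.univ.filter fun y : ι → R => (Finset.univ.filter fun x => y x ≠ 0) = Z) =
      Fintype.piFinset fun x => if x ∈ Z then Finset.univ.erase (0 : R) else {0} := by
    ext y
    simp only [Finset.mem_filter, Finset.mem_univ, true_and, Fintype.mem_piFinset,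
      Finset.ext_iff]
    refine forall_congr' fun x => ?_
    split_ifs with hx <;> simp [hx]
  rw [h, Fintype.card_piFinset, Fintype.prod_congr _
    (fun x => if x ∈ Z then Fintype.card R - 1 else 1) fun x => by split_ifs <;> simp]
  simp

theorem sum_support_repr {R E M : Type*} [Semiring R] [Fintype R] [AddCommMonoid E] [Module R E]
    [Fintype E] [Fintype ι] [AddCommMonoid M] (b : Basis ι R E) (φ : Finset ι → M) :
    ∑ y : E, φ (b.repr y).support = ∑ Z : Finset ι, (Fintype.card R - 1) ^ Z.card • φ Z := by
  classical
  rw [Fintype.sum_equiv b.equivFun.toEquiv (fun y => φ (b.repr y).support)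
    (fun y : ι → R => φ (Finset.univ.filter fun x => y x ≠ 0)) fun y =>
      congrArg φ (by ext x; rw [Finsupp.mem_support_iff, Finset.mem_filter]; simp),
    ← Finset.sum_fiberwise_of_maps_to (t := (Finset.univ : Finset (Finset ι)))
      (g := fun y : ι → R => Finset.univ.filter fun x => y x ≠ 0) fun _ _ => Finset.mem_univ _]
  refine Finset.sum_congr rfl fun Z _ => ?_
  rw [Finset.sum_congr rfl fun y hy => congrArg φ (Finset.mem_filter.mp hy).2,
    Finset.sum_const, card_filter_support_eq]

open Classical in
/-- The vectors of the `(j + 1)`-st space of a flag which are not in the `j`-th one. -/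
def Flag.newVecs [Fintype K] (V : Flag K n d) (j : Fin n) : Finset (Fin d → K) :=
  Finset.univ.filter fun y => y ∈ V.space j.succ ∧ y ∉ V.space j.castSucc

open Classical in
theorem sum_newVecs_relPos [Fintype K] {M : Type*} [AddCommMonoid M] (V V' : Flag K n d)
    (i j : Fin n) (φ : Matrix (Fin n) (Fin n) ℕ → M) :
    ∑ y ∈ V'.newVecs j, φ (relPos V (V'.addVec i j y)) =
      ∑ Z : Finset (Cells (relPos V V')), (Fintype.card K - 1) ^ Z.card •
        if IsGreatest ((fun x => x.1.2) '' (Z : Set (Cells (relPos V V')))) j then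
          φ (shiftMatrix (fun x => x.1.1) (fun x => x.1.2) i j Z) else 0 := by
  obtain ⟨b, hV, hV'⟩ := exists_adapted_basis V V'
  rw [← sum_support_repr b, Flag.newVecs, Finset.sum_filter]
  refine Finset.sum_congr rfl fun y _ => ?_
  by_cases hy : y ∈ V'.space j.succ ∧ y ∉ V'.space j.castSucc
  · rw [if_pos hy, if_pos (hV'.mem_sdiff_iff.mp hy), hV.relPos_addVec hV' hy.1 hy.2]
  · rw [if_neg hy, if_neg (mt hV'.mem_sdiff_iff.mpr hy)]

end AddVec

/-! ### Elementary relative positions -/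

section Elementary

variable {K : Type} [Field K] {n d : ℕ} {i j : Fin n} {a : ℕ} {V V' : Flag K n d}
  {y : Fin d → K}

/-- The lattice-theoretic form of the condition that the relative position of `V` and `V'` is
`D + a E_{ij}` for some diagonal matrix `D`, where `i < j`. -/
structure IsElementary (i j : Fin n) (a : ℕ) (V V' : Flag K n d) : Prop where
  le : ∀ k, V'.space k ≤ V.space k
  eq : ∀ k, k ∉ Set.Ioc i.castSucc j.castSucc → V.space k = V'.space k
  le_sup : ∀ k ∈ Set.Ioc i.castSucc j.castSucc, V.space k ≤ V'.space k ⊔ V.space i.succ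
  inf_le : V.space i.succ ⊓ V'.space j.castSucc ≤ V'.space i.succ
  finrank_eq : finrank K (V.space i.succ) = finrank K (V'.space i.succ) + a

theorem isElementary_zero_iff : IsElementary i j 0 V V' ↔ V = V' := by
  constructor
  · intro h
    have hi : V'.space i.succ = V.space i.succ :=
      Submodule.eq_of_le_of_finrank_eq (h.le _) (by rw [h.finrank_eq, add_zero])
    refine Flag.ext (funext fun k => ?_)
    by_cases hk : k ∈ Set.Ioc i.castSucc j.castSucc
    · refine le_antisymm ((h.le_sup k hk).trans (sup_le le_rfl ?_)) (h.le k)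
      rw [← hi]
      exact V'.mono (Fin.castSucc_lt_iff_succ_le.mp hk.1)
    · exact h.eq k hk
  · rintro rfl
    exact ⟨fun _ => le_rfl, fun _ _ => rfl, fun _ _ => le_sup_left, inf_le_left, rfl⟩

theorem succ_mem_Ioc_castSucc (hij : i < j) : i.succ ∈ Set.Ioc i.castSucc j.castSucc :=
  ⟨Fin.castSucc_lt_succ, Fin.castSucc_lt_iff_succ_le.mp (Fin.castSucc_lt_castSucc_iff.mpr hij)⟩

theorem IsElementary.of_addVec (hij : i < j) (hy : y ∈ V'.space j.succ)
    (hy' : y ∉ V'.space j.castSucc) (h : IsElementary i j a V (V'.addVec i j y)) :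
    IsElementary i j (a + 1) V V' ∧ y ∈ V.space i.succ ∧ y ∉ V'.space i.succ := by
  have hi := succ_mem_Ioc_castSucc hij
  have hyi : y ∉ V'.space i.succ := fun hm => hy' (V'.mono hi.2 hm)
  have hspace := @Flag.addVec_space_of_mem K _ n d V' i j y
  have hle := V'.le_addVec i j y
  have hyV : y ∈ V.space i.succ := by
    refine h.le _ ?_
    rw [hspace hy hi]
    exact Submodule.mem_sup_right (Submodule.mem_span_singleton_self y)
  refine ⟨⟨fun k => (hle k).trans (h.le k), fun k hk => ?_, fun k hk => ?_, ?_, ?_⟩, hyV, hyi⟩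
  · rw [h.eq k hk, Flag.addVec_space_of_notMem hk]
  · refine (h.le_sup k hk).trans (sup_le ?_ le_sup_right)
    rw [hspace hy hk]
    exact sup_le_sup le_rfl ((Submodule.span_singleton_le_iff_mem _ _).mpr hyV)
  · rintro v ⟨hv, hv'⟩
    have hsup := h.inf_le ⟨hv, hle _ hv'⟩
    rw [hspace hy hi] at hsup
    obtain ⟨u, hu, z, hz, rfl⟩ := Submodule.mem_sup.mp hsup
    obtain ⟨c, rfl⟩ := Submodule.mem_span_singleton.mp hz
    have hcy : c • y ∈ V'.space j.castSucc :=
      (Submodule.add_mem_iff_right _ (V'.mono hi.2 hu)).mp hv'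
    have hc : c = 0 := by
      by_contra hc
      exact hy' ((Submodule.smul_mem_iff _ hc).mp hcy)
    simpa [hc] using hu
  · rw [h.finrank_eq, hspace hy hi, Submodule.finrank_sup_span_singleton hyi]
    lia

theorem IsElementary.mem_of_mem (hij : i < j) (h : IsElementary i j a V V')
    (hyV : y ∈ V.space i.succ) (hy : y ∉ V'.space i.succ) :
    y ∈ V'.space j.succ ∧ y ∉ V'.space j.castSucc := by
  refine ⟨?_, fun hm => hy (h.inf_le ⟨hyV, hm⟩)⟩
  rw [← h.eq _ fun hj => hj.2.not_gt Fin.castSucc_lt_succ]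
  exact V.mono (Fin.succ_le_succ_iff.mpr hij.le) hyV

theorem IsElementary.addVec (hij : i < j) (h : IsElementary i j (a + 1) V V')
    (hyV : y ∈ V.space i.succ) (hyi : y ∉ V'.space i.succ) :
    IsElementary i j a V (V'.addVec i j y) := by
  have hi := succ_mem_Ioc_castSucc hij
  have hj : j.castSucc ∈ Set.Ioc i.castSucc j.castSucc :=
    ⟨Fin.castSucc_lt_castSucc_iff.mpr hij, le_rfl⟩
  have hy := (h.mem_of_mem hij hyV hyi).1
  have hspace := @Flag.addVec_space_of_mem K _ n d V' i j y
  have hspan := (Submodule.span_singleton_le_iff_mem _ _).mpr hyV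
  refine ⟨fun k => ?_, fun k hk => ?_, fun k hk => ?_, ?_, ?_⟩
  · by_cases hk : k ∈ Set.Ioc i.castSucc j.castSucc
    · rw [hspace hy hk]
      exact sup_le (h.le k) (hspan.trans (V.mono (Fin.castSucc_lt_iff_succ_le.mp hk.1)))
    · rw [Flag.addVec_space_of_notMem hk]
      exact h.le k
  · rw [Flag.addVec_space_of_notMem hk, h.eq k hk]
  · exact (h.le_sup k hk).trans (sup_le_sup (V'.le_addVec i j y k) le_rfl)
  · rw [hspace hy hj, hspace hy hi, sup_comm, inf_comm, sup_inf_assoc_of_le _ hspan, sup_comm,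
      inf_comm]
    exact sup_le_sup h.inf_le le_rfl
  · rw [hspace hy hi, Submodule.finrank_sup_span_singleton hyi, h.finrank_eq]
    lia

theorem isElementary_addVec_iff (hij : i < j) :
    (y ∈ V'.space j.succ ∧ y ∉ V'.space j.castSucc) ∧ IsElementary i j a V (V'.addVec i j y) ↔
      IsElementary i j (a + 1) V V' ∧ y ∈ V.space i.succ ∧ y ∉ V'.space i.succ :=
  ⟨fun h => h.2.of_addVec hij h.1.1 h.1.2,
    fun h => ⟨h.1.mem_of_mem hij h.2.1 h.2.2, h.1.addVec hij h.2.1 h.2.2⟩⟩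

open Classical in
theorem card_filter_mem_notMem {K E M : Type*} [DivisionRing K] [Fintype K] [AddCommGroup E]
    [Module K E] [Fintype E] [Ring M] {S R : Submodule K E} (h : R ≤ S) :
    ((Finset.univ.filter fun y => y ∈ S ∧ y ∉ R).card : M) =
      (Fintype.card K : M) ^ finrank K S - (Fintype.card K : M) ^ finrank K R := by
  have hcard : ∀ W : Submodule K E,
      (Finset.univ.filter fun y => y ∈ W).card = Fintype.card K ^ finrank K W := fun W => by
    rw [← Fintype.card_subtype]
    exact Module.card_eq_pow_finrank (K := K) (V := W)
  rw [Finset.filter_and_not,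
    Finset.cast_card_sdiff (Finset.monotone_filter_right _ fun _ _ hy => h hy), hcard, hcard]
  push_cast
  rfl

open Classical in
theorem sum_newVecs_isElementary [Fintype K] {M : Type*} [Ring M] (hij : i < j) (a : ℕ)
    (V V' : Flag K n d) :
    (∑ y ∈ V'.newVecs j, if IsElementary i j a V (V'.addVec i j y) then (1 : M) else 0) =
      (if IsElementary i j (a + 1) V V' then 1 else 0) *
        ((Fintype.card K : M) ^ (finrank K (V'.space i.succ) + (a + 1)) -
          (Fintype.card K : M) ^ finrank K (V'.space i.succ)) := by
  rw [Finset.sum_boole, Flag.newVecs, Finset.filter_filter]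
  simp only [isElementary_addVec_iff hij]
  by_cases h : IsElementary i j (a + 1) V V'
  · simp only [h, true_and, if_true, one_mul]
    rw [card_filter_mem_notMem (h.le _), h.finrank_eq]
  · simp [h]

end Elementary

section ElementaryRelPos

variable {K : Type} [Field K] {n d : ℕ} {i j : Fin n} {a : ℕ} {V V' V'' : Flag K n d}
  {ι : Type*} {b : Basis ι K (Fin d → K)} {f g : ι → Fin n}

theorem isElementary_labels_iff {p q : Fin n} (hij : i < j) :
    ((∀ k : Fin (n + 1), q.castSucc < k → p.castSucc < k) ∧
      (∀ k ∉ Set.Ioc i.castSucc j.castSucc, p.castSucc < k ↔ q.castSucc < k) ∧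
      (∀ k ∈ Set.Ioc i.castSucc j.castSucc, p.castSucc < k → q.castSucc < k ∨ p ≤ i) ∧
      (p ≤ i → q < j → q ≤ i)) ↔ p = q ∨ (p = i ∧ q = j) := by
  constructor
  · rintro ⟨hle, heq, hsup, hinf⟩
    have hpq := hle q.succ
    have hp := heq p.succ
    have hq := heq q.castSucc
    have hpi := hsup p.succ
    simp only [Set.mem_Ioc, Fin.lt_def, Fin.le_def, Fin.val_castSucc, Fin.val_succ,
      Fin.ext_iff] at *
    lia
  · rintro (rfl | ⟨rfl, rfl⟩)
    · exact ⟨fun _ => id, fun _ _ => Iff.rfl, fun _ _ => Or.inl, fun h _ => h⟩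
    · simp only [Set.mem_Ioc, Fin.lt_def, Fin.le_def, Fin.val_castSucc] at hij ⊢
      exact ⟨fun _ _ => by lia, fun _ _ => by lia, fun _ _ => by lia, fun _ => by lia⟩

theorem forall_label_and_countMatrix_iff [Fintype ι] (hij : i ≠ j) :
    (∀ x, f x = g x ∨ (f x = i ∧ g x = j)) ∧ countMatrix f g i j = a ↔
      ∀ r s, r ≠ s → countMatrix f g r s = Matrix.single i j a r s := by
  constructor
  · rintro ⟨hlabel, rfl⟩ r s hrs
    obtain ⟨rfl, rfl⟩ | hne := Classical.em (i = r ∧ j = s)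
    · rw [Matrix.single_apply_same]
    · rw [Matrix.single_apply_of_ne _ _ _ _ _ hne, countMatrix_eq_zero_iff]
      rintro x rfl rfl
      exact (hlabel x).elim hrs fun h => hne ⟨h.1.symm, h.2.symm⟩
  · refine fun h => ⟨fun x => ?_, (h i j hij).trans (Matrix.single_apply_same i j a)⟩
    by_contra! hne
    have hzero := h _ _ hne.1
    rw [Matrix.single_apply_of_ne _ _ _ _ _ fun hx => hne.2 hx.1.symm hx.2.symm,
      countMatrix_eq_zero_iff] at hzero
    exact hzero x rfl rfl

theorem finrank_eq_of_labels [Fintype ι] (hij : i < j) (hV : IsAdapted V b f)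
    (hV' : IsAdapted V' b g) (h : ∀ x, f x = g x ∨ (f x = i ∧ g x = j)) :
    finrank K (V.space i.succ) = finrank K (V'.space i.succ) + countMatrix f g i j := by
  classical
  have hcoe : ∀ f : ι → Fin n, {x | (f x).castSucc < i.succ} =
      ((Finset.univ.filter fun x => f x ≤ i : Finset ι) : Set ι) := fun f => by
    ext x
    simp [Fin.castSucc_lt_succ_iff]
  rw [hV, hV', hcoe, hcoe, finrank_span_image, finrank_span_image, countMatrix_apply,
    ← Finset.card_union_of_disjoint]
  · congr 1
    ext x
    simp only [Finset.mem_union, Finset.mem_filter, Finset.mem_univ, true_and]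
    grind
  · rw [Finset.disjoint_filter]
    rintro x - hx ⟨-, rfl⟩
    exact hx.not_gt hij

theorem IsAdapted.isElementary_iff [Fintype ι] (hij : i < j) (hV : IsAdapted V b f)
    (hV' : IsAdapted V' b g) :
    IsElementary i j a V V' ↔
      (∀ x, f x = g x ∨ (f x = i ∧ g x = j)) ∧ countMatrix f g i j = a := by
  have hlattice : ((∀ k, V'.space k ≤ V.space k) ∧
      (∀ k, k ∉ Set.Ioc i.castSucc j.castSucc → V.space k = V'.space k) ∧
      (∀ k ∈ Set.Ioc i.castSucc j.castSucc, V.space k ≤ V'.space k ⊔ V.space i.succ) ∧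
      V.space i.succ ⊓ V'.space j.castSucc ≤ V'.space i.succ) ↔
        ∀ x, f x = g x ∨ (f x = i ∧ g x = j) := by
    simp only [hV'.sup_eq hV]
    simp only [hV _, hV' _, ← span_image_inter, span_image_le_span_image_iff,
      (span_image_injective b).eq_iff, ← isElementary_labels_iff hij]
    simp only [Set.subset_def, Set.ext_iff, Set.mem_inter_iff, Set.mem_ofPred_eq, and_imp]
    simp only [Fin.castSucc_lt_succ_iff, Fin.castSucc_lt_castSucc_iff, forall_and]
    exact ⟨fun h => ⟨fun x k => h.1 k x, fun x k hk => h.2.1 k hk x,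
        fun x k hk => h.2.2.1 k hk x, h.2.2.2⟩,
      fun h => ⟨fun k x => h.1 x k, fun k hk x => h.2.1 x k hk,
        fun k hk x => h.2.2.1 x k hk, h.2.2.2⟩⟩
  constructor
  · intro h
    have hlabels := hlattice.mp ⟨h.le, h.eq, h.le_sup, h.inf_le⟩
    have hdim := h.finrank_eq
    rw [finrank_eq_of_labels hij hV hV' hlabels] at hdim
    exact ⟨hlabels, Nat.add_left_cancel hdim⟩
  · rintro ⟨hlabels, rfl⟩
    obtain ⟨hle, heq, hsup, hinf⟩ := hlattice.mpr hlabels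
    exact ⟨hle, heq, hsup, hinf, finrank_eq_of_labels hij hV hV' hlabels⟩

theorem IsAdapted.eq_iff (hV : IsAdapted V b f) (hV' : IsAdapted V' b g) :
    V = V' ↔ f = g := by
  refine ⟨fun h => funext fun x => ?_, ?_⟩
  · have hmem : ∀ k, (f x).castSucc < k ↔ (g x).castSucc < k := fun k => by
      have hspan := (hV k).symm.trans ((congrArg (fun W => W.space k) h).trans (hV' k))
      exact Set.ext_iff.mp (span_image_injective b hspan) x
    have hle := (hmem (f x).succ).mp Fin.castSucc_lt_succ
    have hge := (hmem (g x).succ).mpr Fin.castSucc_lt_succ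
    rw [Fin.castSucc_lt_succ_iff] at hle hge
    exact hge.antisymm hle
  · rintro rfl
    exact Flag.ext (funext fun k => (hV k).trans (hV' k).symm)

theorem isElementary_iff (hij : i < j) :
    IsElementary i j a V V' ↔ ∀ r s, r ≠ s → relPos V V' r s = Matrix.single i j a r s := by
  obtain ⟨b, hV, hV'⟩ := exists_adapted_basis V V'
  rw [hV.isElementary_iff hij hV', forall_label_and_countMatrix_iff hij.ne, ← hV.relPos_eq hV']

theorem eq_iff_relPos_eq_zero : V = V' ↔ ∀ r s, r ≠ s → relPos V V' r s = 0 := by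
  obtain ⟨b, hV, hV'⟩ := exists_adapted_basis V V'
  simp only [hV.eq_iff hV', hV.relPos_eq hV', countMatrix_eq_zero_iff, funext_iff]
  grind

theorem ext_of_offDiag_of_colSum {ι M : Type*} [Fintype ι] [AddCancelCommMonoid M]
    {A B : Matrix ι ι M} (hoff : ∀ r s, r ≠ s → A r s = B r s)
    (hcol : ∀ s, ∑ r, A r s = ∑ r, B r s) : A = B := by
  classical
  have hdiag : ∀ s, A s s = B s s := fun s => by
    have h := hcol s
    rw [← Finset.add_sum_erase _ _ (Finset.mem_univ s),
      ← Finset.add_sum_erase _ _ (Finset.mem_univ s),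
      Finset.sum_congr rfl fun r hr => hoff r s (Finset.ne_of_mem_erase hr)] at h
    exact add_right_cancel h
  ext r s
  obtain rfl | hrs := eq_or_ne r s
  exacts [hdiag r, hoff r s hrs]

theorem finrank_succ_eq_add_colSum (V V' : Flag K n d) (t : Fin n) :
    finrank K (V'.space t.succ) = finrank K (V'.space t.castSucc) + ∑ r, relPos V V' r t := by
  simp only [finrank_right V V', corner, sum_castSucc_lt_succ, Finset.sum_add_distrib,
    Fin.castSucc_lt_last, Finset.filter_true]

theorem colSum_relPos_eq (V V' V'' : Flag K n d) (t : Fin n) :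
    ∑ r, relPos V V'' r t = ∑ r, relPos V' V'' r t :=
  Nat.add_left_cancel <|
    (finrank_succ_eq_add_colSum V V'' t).symm.trans (finrank_succ_eq_add_colSum V' V'' t)

theorem diagonal_add_single_offDiag {r s : Fin n} (D : Fin n → ℕ) (hrs : r ≠ s) :
    (Matrix.diagonal D + Matrix.single i j a) r s = Matrix.single i j a r s := by
  rw [Matrix.add_apply, Matrix.diagonal_apply_ne _ hrs, zero_add]

theorem relPos_eq_diagonal_add_single_iff (hij : i < j) {D : Fin n → ℕ} :
    relPos V V' = Matrix.diagonal D + Matrix.single i j a ↔ IsElementary i j a V V' ∧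
      ∀ t, ∑ r, relPos V V' r t = ∑ r, (Matrix.diagonal D + Matrix.single i j a) r t := by
  rw [isElementary_iff hij]
  constructor
  · intro h
    exact ⟨fun r s hrs => by rw [h, diagonal_add_single_offDiag D hrs], fun t => by rw [h]⟩
  · rintro ⟨hoff, hcol⟩
    exact ext_of_offDiag_of_colSum
      (fun r s hrs => by rw [hoff r s hrs, diagonal_add_single_offDiag D hrs]) hcol

end ElementaryRelPos

/-! ### Structure functions that are polynomial in `q` -/

section Polynomiality

open Polynomial

instance instFintypeField (κ : OddField) : Fintype κ.K := Fintype.ofFinite _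

/-- The order of the field. -/
def OddField.q (κ : OddField) : ℕ := κ.p ^ κ.r

theorem OddField.card_K (κ : OddField) : Fintype.card κ.K = κ.q := by
  rw [← Nat.card_eq_fintype_card]
  exact GaloisField.card κ.p κ.r κ.pos

theorem OddField.one_lt_q (κ : OddField) : 1 < κ.q :=
  Nat.one_lt_pow κ.pos κ.prime.out.one_lt

theorem OddField.infinite_range_q : (Set.range OddField.q).Infinite := by
  refine (Nat.infinite_setOfPred_prime.sdiff (Set.finite_singleton 2)).mono ?_
  rintro p ⟨hp, hne⟩
  exact ⟨⟨p, 1, ⟨hp⟩, hp.odd_of_ne_two hne, one_ne_zero⟩, pow_one p⟩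

theorem dvd_of_eval_q_dvd {f g : ℤ[X]} (hg : g.Monic)
    (h : ∀ κ : OddField, g.eval (κ.q : ℤ) ∣ f.eval (κ.q : ℤ)) : g ∣ f := by
  refine dvd_of_infinite_eval_dvd_eval hg <|
    (OddField.infinite_range_q.image (Nat.cast_injective (R := ℤ)).injOn).mono ?_
  rintro _ ⟨_, ⟨κ, rfl⟩, rfl⟩
  exact h κ

variable {n d : ℕ} {F G : ConvFamily n d}

theorem ConvFamily.mul_apply (F G : ConvFamily n d) (κ : OddField) (V V' : Flag κ.K n d) :
    (F * G) κ V V' = ∑ V'', F κ V V'' * G κ V'' V' :=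
  rfl

theorem ConvFamily.ext (h : ∀ κ V V', F κ V V' = G κ V V') : F = G :=
  funext fun κ => Matrix.ext (h κ)

/-- The value of `F` at a pair of flags is a polynomial in `q` which depends only on the relative
position of the pair. -/
def IsPolynomial (F : ConvFamily n d) : Prop :=
  ∃ c : Matrix (Fin n) (Fin n) ℕ → ℤ[X], ∀ (κ : OddField) (V V' : Flag κ.K n d),
    F κ V V' = ((c (relPos V V')).eval (κ.q : ℤ) : ℤ)

/-- All values of `F` are integers. -/
def IsIntegerValued (F : ConvFamily n d) : Prop :=
  ∀ κ, F κ ∈ (Int.castRingHom ℝ).mapMatrix.range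

theorem isIntegerValued_iff :
    IsIntegerValued F ↔ ∀ (κ : OddField) (V V' : Flag κ.K n d), ∃ m : ℤ, F κ V V' = m := by
  constructor
  · intro hF κ V V'
    obtain ⟨M, hM⟩ := hF κ
    exact ⟨M V V', by rw [← hM]; rfl⟩
  · intro hF κ
    choose M hM using hF κ
    exact ⟨Matrix.of M, Matrix.ext fun V V' => (hM V V').symm⟩

theorem IsIntegerValued.mul (hF : IsIntegerValued F) (hG : IsIntegerValued G) :
    IsIntegerValued (F * G) :=
  fun κ => mul_mem (hF κ) (hG κ)

theorem IsPolynomial.isIntegerValued (hF : IsPolynomial F) : IsIntegerValued F := by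
  obtain ⟨c, hc⟩ := hF
  exact isIntegerValued_iff.mpr fun κ V V' => ⟨_, hc κ V V'⟩

theorem isPolynomial_one : IsPolynomial (1 : ConvFamily n d) := by
  classical
  refine ⟨fun C => if ∀ r s, r ≠ s → C r s = 0 then 1 else 0, fun κ V V' => ?_⟩
  change (1 : Matrix (Flag κ.K n d) (Flag κ.K n d) ℝ) V V' = _
  simp only [Matrix.one_apply, eq_iff_relPos_eq_zero]
  split_ifs <;> simp

theorem IsPolynomial.sum_newVecs (hF : IsPolynomial F) (i j : Fin n) :
    IsPolynomial (n := n) (d := d) fun _ => Matrix.of fun V V' =>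
      ∑ y ∈ V'.newVecs j, F _ V (V'.addVec i j y) := by
  classical
  obtain ⟨c, hc⟩ := hF
  refine ⟨fun C => ∑ Z : Finset (Cells C), (X - 1) ^ Z.card *
    if IsGreatest ((fun x => x.1.2) '' (Z : Set (Cells C))) j then
      c (shiftMatrix (fun x => x.1.1) (fun x => x.1.2) i j Z) else 0, fun κ V V' => ?_⟩
  simp only [Matrix.of_apply, hc]
  rw [sum_newVecs_relPos V V' i j fun C => (((c C).eval (κ.q : ℤ) : ℤ) : ℝ), eval_finsetSum,
    Int.cast_sum]
  refine Finset.sum_congr rfl fun Z _ => ?_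
  rw [κ.card_K, nsmul_eq_mul, Nat.cast_pow, Nat.cast_sub κ.one_lt_q.le]
  split_ifs <;> simp

theorem IsPolynomial.of_mul_monic (hG : IsPolynomial G) (hF : IsIntegerValued F)
    {g : Matrix (Fin n) (Fin n) ℕ → ℤ[X]} (hg : ∀ C, (g C).Monic)
    (hg0 : ∀ C (κ : OddField), (g C).eval (κ.q : ℤ) ≠ 0)
    (h : ∀ κ V V', G κ V V' = F κ V V' * ((g (relPos V V')).eval (κ.q : ℤ) : ℤ)) :
    IsPolynomial F := by
  obtain ⟨c, hc⟩ := hG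
  have hdvd : ∀ C ∈ Theta n d, g C ∣ c C := fun C hC => by
    refine dvd_of_eval_q_dvd (hg C) fun κ => ?_
    obtain ⟨V, V', rfl⟩ := exists_relPos_eq κ.K hC
    obtain ⟨m, hm⟩ := isIntegerValued_iff.mp hF κ V V'
    have hval := h κ V V'
    rw [hc, hm] at hval
    exact ⟨m, by rw [mul_comm]; exact_mod_cast hval⟩
  refine ⟨fun C => c C /ₘ g C, fun κ V V' => ?_⟩
  obtain ⟨f, hf⟩ := hdvd _ (relPos_mem_Theta V V')
  have hval := h κ V V'
  rw [hc, hf, eval_mul, Int.cast_mul, mul_comm] at hval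
  dsimp only
  rw [hf, mul_divByMonic_cancel_left f (hg _)]
  exact (mul_right_cancel₀ (Int.cast_ne_zero.mpr (hg0 _ κ)) hval).symm

open Classical in
/-- The sum of the characteristic functions of the orbits of the matrices `D + a E_{ij}` with `D`
diagonal, for `i < j`. -/
def elemFun (n d : ℕ) (i j : Fin n) (a : ℕ) : ConvFamily n d :=
  fun _ => Matrix.of fun V V' => if IsElementary i j a V V' then 1 else 0

theorem elemFun_zero (i j : Fin n) : elemFun n d i j 0 = 1 := by
  refine ConvFamily.ext fun κ V V' => ?_
  change _ = (1 : Matrix (Flag κ.K n d) (Flag κ.K n d) ℝ) V V'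
  simp only [elemFun, Matrix.of_apply, Matrix.one_apply, isElementary_zero_iff]

theorem isIntegerValued_elemFun (i j : Fin n) (a : ℕ) : IsIntegerValued (elemFun n d i j a) := by
  refine isIntegerValued_iff.mpr fun κ V V' => ?_
  by_cases h : IsElementary i j a V V'
  exacts [⟨1, by simp [elemFun, h]⟩, ⟨0, by simp [elemFun, h]⟩]

theorem sum_newVecs_mul_elemFun (F : ConvFamily n d) {i j : Fin n} (hij : i < j) (a : ℕ)
    (κ : OddField) (V V' : Flag κ.K n d) :
    ∑ y ∈ V'.newVecs j, (F * elemFun n d i j a) κ V (V'.addVec i j y) =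
      (F * elemFun n d i j (a + 1)) κ V V' *
        ((κ.q : ℝ) ^ (finrank κ.K (V'.space i.succ) + (a + 1)) -
          (κ.q : ℝ) ^ finrank κ.K (V'.space i.succ)) := by
  simp only [ConvFamily.mul_apply, elemFun, Matrix.of_apply]
  rw [Finset.sum_comm, Finset.sum_mul]
  refine Finset.sum_congr rfl fun V'' _ => ?_
  rw [← Finset.mul_sum, sum_newVecs_isElementary hij, κ.card_K, mul_assoc]

theorem IsPolynomial.mul_elemFun (hF : IsPolynomial F) {i j : Fin n} (hij : i < j) (a : ℕ) :
    IsPolynomial (F * elemFun n d i j a) := by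
  induction a with
  | zero => rwa [elemFun_zero, mul_one]
  | succ a ih =>
    refine (ih.sum_newVecs i j).of_mul_monic
      (hF.isIntegerValued.mul (isIntegerValued_elemFun i j (a + 1)))
      (g := fun C => X ^ (corner C (Fin.last n) i.succ + (a + 1)) -
        X ^ corner C (Fin.last n) i.succ)
      (fun C => ?_) (fun C κ => ?_) (fun κ V V' => ?_)
    · refine monic_X_pow_sub ?_
      rw [degree_X_pow]
      exact_mod_cast Nat.lt_add_of_pos_right a.succ_pos
    · simp only [eval_sub, eval_pow, eval_X]
      refine sub_ne_zero.mpr (ne_of_gt ?_)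
      exact pow_lt_pow_right₀ (by exact_mod_cast κ.one_lt_q) (Nat.lt_add_of_pos_right a.succ_pos)
    · rw [Matrix.of_apply, sum_newVecs_mul_elemFun F hij, finrank_right V V']
      simp

theorem IsPolynomial.mul_orbitFun (hF : IsPolynomial F) {i j : Fin n} (hij : i < j)
    (D : Fin n → ℕ) (a : ℕ) :
    IsPolynomial (F * orbitFun n d (Matrix.diagonal D + Matrix.single i j a)) := by
  classical
  obtain ⟨c, hc⟩ := hF.mul_elemFun hij a
  refine ⟨fun C => if ∀ t, ∑ r, C r t =
    ∑ r, (Matrix.diagonal D + Matrix.single i j a) r t then c C else 0, fun κ V V' => ?_⟩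
  have hval := hc κ V V'
  simp only [ConvFamily.mul_apply, orbitFun, elemFun, Matrix.of_apply,
    relPos_eq_diagonal_add_single_iff hij, fun V'' => colSum_relPos_eq V'' V V'] at hval ⊢
  split_ifs with hcol
  · simp only [hcol, implies_true, and_true, hval]
  · simp only [hcol, and_false, if_false, mul_zero, Finset.sum_const_zero, eval_zero, Int.cast_zero]

/-- The transpose of a family of matrices. -/
def ConvFamily.transpose (F : ConvFamily n d) : ConvFamily n d := fun κ => (F κ).transpose

theorem ConvFamily.transpose_mul (F G : ConvFamily n d) :
    (F * G).transpose = G.transpose * F.transpose :=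
  funext fun κ => Matrix.transpose_mul (F κ) (G κ)

theorem orbitFun_transpose (M : Matrix (Fin n) (Fin n) ℕ) :
    (orbitFun n d M).transpose = orbitFun n d M.transpose := by
  refine ConvFamily.ext fun κ V V' => ?_
  simp only [ConvFamily.transpose, orbitFun, Matrix.transpose_apply, Matrix.of_apply,
    relPos_swap V' V, Matrix.transpose_inj]

theorem IsPolynomial.transpose (hF : IsPolynomial F) : IsPolynomial F.transpose := by
  obtain ⟨c, hc⟩ := hF
  refine ⟨fun C => c C.transpose, fun κ V V' => ?_⟩
  change F κ V' V = _
  rw [hc, relPos_swap V V']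

theorem IsPolynomial.orbitFun_mul (hF : IsPolynomial F) {i j : Fin n} (hij : j < i)
    (D : Fin n → ℕ) (a : ℕ) :
    IsPolynomial (orbitFun n d (Matrix.diagonal D + Matrix.single i j a) * F) := by
  have h := (hF.transpose.mul_orbitFun hij D a).transpose
  rwa [ConvFamily.transpose_mul, orbitFun_transpose, Matrix.transpose_add,
    Matrix.diagonal_transpose, Matrix.transpose_single] at h

end Polynomiality

/-! ### The preorder on matrices -/

section Preceq

theorem sum_Iic_Ici_add_corner {m n : ℕ} (C : Matrix (Fin m) (Fin n) ℕ) (i : Fin m) (j : Fin n) :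
    ∑ r ∈ Finset.Iic i, ∑ s ∈ Finset.Ici j, C r s + corner C i.succ j.castSucc =
      corner C i.succ (Fin.last n) := by
  have hrows : (Finset.univ.filter fun r : Fin m => r.castSucc < i.succ) = Finset.Iic i := by
    ext r; simp [Fin.castSucc_lt_succ_iff]
  have hcols : (Finset.univ.filter fun s : Fin n => ¬ s.castSucc < j.castSucc) = Finset.Ici j := by
    ext s; simp
  simp only [corner, hrows, ← Finset.sum_add_distrib, Fin.castSucc_lt_last, Finset.filter_true]
  refine Finset.sum_congr rfl fun r _ => ?_
  rw [← hcols, add_comm, Finset.sum_filter_add_sum_filter_not]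

theorem sum_Ici_Iic_add_corner {m n : ℕ} (C : Matrix (Fin m) (Fin n) ℕ) (i : Fin m) (j : Fin n) :
    ∑ r ∈ Finset.Ici i, ∑ s ∈ Finset.Iic j, C r s + corner C i.castSucc j.succ =
      corner C (Fin.last m) j.succ := by
  have h := sum_Iic_Ici_add_corner C.transpose j i
  simp only [corner_transpose, Matrix.transpose_apply] at h
  rwa [Finset.sum_comm] at h

variable {n : ℕ} {A B C : Matrix (Fin n) (Fin n) ℕ}

theorem Preceq.transpose (h : Preceq B C) : Preceq B.transpose C.transpose := by
  refine ⟨fun i j hij => ?_, fun i j hij => ?_⟩ <;>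
    simp only [Matrix.transpose_apply] <;>
    rw [Finset.sum_comm, Finset.sum_comm (f := fun r s => C s r)]
  · exact h.2 j i hij
  · exact h.1 j i hij

theorem corner_eq_of_preceq_of_le (hBC : Preceq B C) (hCB : Preceq C B)
    (hrow : ∀ k, corner B k (Fin.last n) = corner C k (Fin.last n)) {k l : Fin (n + 1)}
    (hkl : k ≤ l) : corner B k l = corner C k l := by
  obtain rfl | ⟨i, rfl⟩ := Fin.eq_zero_or_eq_succ k
  · rw [corner_zero_left, corner_zero_left]
  obtain ⟨j, rfl⟩ | rfl := Fin.eq_castSucc_or_eq_last l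
  · have hij : i < j := Fin.castSucc_lt_castSucc_iff.mp (Fin.castSucc_lt_iff_succ_le.mpr hkl)
    have hB := sum_Iic_Ici_add_corner B i j
    have hC := sum_Iic_Ici_add_corner C i j
    rw [le_antisymm (hBC.1 i j hij) (hCB.1 i j hij), hrow] at hB
    exact Nat.add_left_cancel (hB.trans hC.symm)
  · exact hrow _

theorem corner_last_eq_of_preceq (hBC : Preceq B C) (hCB : Preceq C B)
    (hrow : ∀ k, corner B k (Fin.last n) = corner C k (Fin.last n)) (l : Fin (n + 1)) :
    corner B (Fin.last n) l = corner C (Fin.last n) l := by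
  obtain ⟨i, rfl⟩ | rfl := Fin.eq_castSucc_or_eq_last l
  · obtain h0 | ⟨j, hj⟩ := Fin.eq_zero_or_eq_succ i.castSucc
    · rw [h0, corner_zero_right, corner_zero_right]
    · have hji : j < i := by
        rw [← Fin.castSucc_lt_castSucc_iff, hj]
        exact Fin.castSucc_lt_succ
      have hB := sum_Ici_Iic_add_corner B i j
      rw [le_antisymm (hBC.2 i j hji) (hCB.2 i j hji),
        corner_eq_of_preceq_of_le hBC hCB hrow hj.le, sum_Ici_Iic_add_corner, ← hj] at hB
      exact hB.symm
  · exact hrow _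

theorem eq_of_preceq_preceq (hBC : Preceq B C) (hCB : Preceq C B)
    (hrow : ∀ k, corner B k (Fin.last n) = corner C k (Fin.last n)) : B = C := by
  have hcorner : corner B = corner C := by
    ext k l
    obtain hkl | hlk := le_total k l
    · exact corner_eq_of_preceq_of_le hBC hCB hrow hkl
    · rw [← corner_transpose, ← corner_transpose C]
      refine corner_eq_of_preceq_of_le hBC.transpose hCB.transpose (fun k => ?_) hlk
      rw [corner_transpose, corner_transpose, corner_last_eq_of_preceq hBC hCB hrow]
  rw [← secondDiff_corner B, hcorner, secondDiff_corner]

end Preceq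

/-! ### Galleries of flags -/

section Gallery

variable {K : Type} [Field K] {n d : ℕ} {L L' : List (Matrix (Fin n) (Fin n) ℕ)}
  {V V' U W : Flag K n d}

/-- Flags `V = V⁰, V¹, …, Vᴺ = V'` whose successive relative positions are the given matrices.
A product of characteristic functions of orbits is supported on the pairs joined by a gallery. -/
def IsGallery : List (Matrix (Fin n) (Fin n) ℕ) → Flag K n d → Flag K n d → Prop
  | [], V, V' => V = V'
  | C :: L, V, V' => ∃ W, relPos V W = C ∧ IsGallery L W V'

theorem isGallery_append :
    IsGallery (L ++ L') V V' ↔ ∃ W, IsGallery L V W ∧ IsGallery L' W V' := by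
  induction L generalizing V with
  | nil => simp [IsGallery]
  | cons C L ih =>
    simp only [List.cons_append, IsGallery, ih]
    exact ⟨fun ⟨U, hU, W, hL, hL'⟩ => ⟨W, ⟨U, hU, hL⟩, hL'⟩,
      fun ⟨W, ⟨U, hU, hL⟩, hL'⟩ => ⟨U, hU, W, hL, hL'⟩⟩

theorem IsGallery.mem_Theta {C : Matrix (Fin n) (Fin n) ℕ} (h : IsGallery L V V') (hC : C ∈ L) :
    C ∈ Theta n d := by
  induction L generalizing V with
  | nil => cases hC
  | cons C' L ih =>
    obtain ⟨W, rfl, hW⟩ := h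
    obtain rfl | hC := List.mem_cons.mp hC
    · exact relPos_mem_Theta V W
    · exact ih hW hC

theorem IsGallery.finrank_eq (h : IsGallery L V V') {U U' : Flag K n d} (h' : IsGallery L U U')
    (hL : L ≠ []) (k : Fin (n + 1)) : finrank K (V.space k) = finrank K (U.space k) := by
  obtain ⟨C, L, rfl⟩ := List.exists_cons_of_ne_nil hL
  obtain ⟨W, rfl, -⟩ := h
  obtain ⟨W', hW', -⟩ := h'
  rw [finrank_left V W, finrank_left U W', hW']

variable {A : Matrix (Fin n) (Fin n) ℕ} {D D' : OffDiag n → Fin n → ℕ} {l l' : List (OffDiag n)}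
  {i j : Fin n} {p : OffDiag n}

/-- The matrices `D_p + a_p E_p`, for `p` in a list of positions. -/
def elemMatrices (A : Matrix (Fin n) (Fin n) ℕ) (D : OffDiag n → Fin n → ℕ)
    (l : List (OffDiag n)) : List (Matrix (Fin n) (Fin n) ℕ) :=
  l.map fun p => elemMatrix A (D p) p

theorem elemMatrices_congr (h : ∀ p ∈ l, D p = D' p) : elemMatrices A D l = elemMatrices A D' l :=
  List.map_congr_left fun p hp => by rw [h p hp]

theorem eq_of_relPos_eq_elemMatrix {E E' : Fin n → ℕ} {W' : Flag K n d}
    (hW : relPos V W = elemMatrix A E p) (hW' : relPos U W' = elemMatrix A E' p)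
    (hdim : ∀ k, finrank K (V.space k) = finrank K (U.space k)) : E = E' := by
  funext t
  have hV := finrank_succ_eq_add_colSum W V t
  rw [hdim, hdim, finrank_succ_eq_add_colSum W' U t, relPos_swap V W, relPos_swap U W', hW,
    hW'] at hV
  simpa [elemMatrix, Finset.sum_add_distrib, Matrix.diagonal_apply] using hV.symm

theorem IsGallery.diag_eq (h : IsGallery (elemMatrices A D l) V V') {U U' : Flag K n d}
    (h' : IsGallery (elemMatrices A D' l) U U')
    (hdim : ∀ k, finrank K (V.space k) = finrank K (U.space k)) : ∀ p ∈ l, D p = D' p := by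
  induction l generalizing V U with
  | nil => simp
  | cons p l ih =>
    obtain ⟨W, hW, hWV⟩ := h
    obtain ⟨W', hW', hWU⟩ := h'
    have hp : D p = D' p := eq_of_relPos_eq_elemMatrix hW hW' hdim
    refine List.forall_mem_cons.mpr ⟨hp, ih hWV hWU fun k => ?_⟩
    rw [finrank_right V W, finrank_right U W', hW, hW']
    exact congrArg (fun E => corner (elemMatrix A E p) (Fin.last n) k) hp

theorem isElementary_of_relPos_upper {E : Fin n → ℕ} (hp : p.1.1 < p.1.2)
    (h : relPos V W = elemMatrix A E p) : IsElementary p.1.1 p.1.2 (A p.1.1 p.1.2) V W :=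
  ((relPos_eq_diagonal_add_single_iff hp).mp h).1

theorem isElementary_of_relPos_lower {E : Fin n → ℕ} (hp : p.1.2 < p.1.1)
    (h : relPos V W = elemMatrix A E p) : IsElementary p.1.2 p.1.1 (A p.1.1 p.1.2) W V := by
  refine ((relPos_eq_diagonal_add_single_iff (D := E) hp).mp ?_).1
  rw [relPos_swap V W, h, elemMatrix, Matrix.transpose_add, Matrix.diagonal_transpose,
    Matrix.transpose_single]

theorem IsElementary.finrank_le {a : ℕ} (h : IsElementary i j a V V') (k : Fin (n + 1)) :
    finrank K (V.space k) ≤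
      finrank K (V'.space k) + if k ∈ Set.Ioc i.castSucc j.castSucc then a else 0 := by
  split_ifs with hk
  · have hsup := Submodule.finrank_mono (h.le_sup k hk)
    have hinf : finrank K (V'.space i.succ) ≤ finrank K ↥(V'.space k ⊓ V.space i.succ) :=
      Submodule.finrank_mono
        (le_inf (V'.mono (Fin.castSucc_lt_iff_succ_le.mp hk.1)) (h.le _))
    have hdim := Submodule.finrank_sup_add_finrank_inf_eq (V'.space k) (V.space i.succ)
    have hi := h.finrank_eq
    omega
  · rw [h.eq k hk, add_zero]

theorem IsGallery.le_of_lower (h : IsGallery (elemMatrices A D l) V V')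
    (hl : ∀ p ∈ l, p.1.2 < p.1.1) (k : Fin (n + 1)) : V.space k ≤ V'.space k := by
  induction l generalizing V with
  | nil => exact (congrArg (fun U : Flag K n d => U.space k) h).le
  | cons p l ih =>
    obtain ⟨W, hVW, hWV'⟩ := h
    rw [List.forall_mem_cons] at hl
    exact ((isElementary_of_relPos_lower hl.1 hVW).le k).trans (ih hWV' hl.2)

theorem IsGallery.le_of_upper (h : IsGallery (elemMatrices A D l) V V')
    (hl : ∀ p ∈ l, p.1.1 < p.1.2) (k : Fin (n + 1)) : V'.space k ≤ V.space k := by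
  induction l generalizing V with
  | nil => exact (congrArg (fun U : Flag K n d => U.space k) h).ge
  | cons p l ih =>
    obtain ⟨W, hVW, hWV'⟩ := h
    rw [List.forall_mem_cons] at hl
    exact (ih hWV' hl.2).trans ((isElementary_of_relPos_upper hl.1 hVW).le k)

theorem IsGallery.space_eq_of_lower (h : IsGallery (elemMatrices A D l) V V')
    (hl : ∀ p ∈ l, p.1.2 < p.1.1) (hj : ∀ p ∈ l, j < p.1.2) :
    V.space j.succ = V'.space j.succ := by
  induction l generalizing V with
  | nil => exact congrArg (fun U : Flag K n d => U.space j.succ) h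
  | cons p l ih =>
    obtain ⟨W, hVW, hWV'⟩ := h
    rw [List.forall_mem_cons] at hl hj
    have hout : j.succ ∉ Set.Ioc p.1.2.castSucc p.1.1.castSucc := fun hk =>
      hk.1.not_ge (Fin.castSucc_lt_iff_succ_le.mp (Fin.castSucc_lt_castSucc_iff.mpr hj.1))
    exact ((isElementary_of_relPos_lower hl.1 hVW).eq _ hout).symm.trans (ih hWV' hl.2 hj.2)

theorem IsGallery.space_eq_of_upper (h : IsGallery (elemMatrices A D l) V V')
    (hl : ∀ p ∈ l, p.1.1 < p.1.2) (hj : ∀ p ∈ l, p.1.2 < j) :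
    V.space j.castSucc = V'.space j.castSucc := by
  induction l generalizing V with
  | nil => exact congrArg (fun U : Flag K n d => U.space j.castSucc) h
  | cons p l ih =>
    obtain ⟨W, hVW, hWV'⟩ := h
    rw [List.forall_mem_cons] at hl hj
    have hout : j.castSucc ∉ Set.Ioc p.1.1.castSucc p.1.2.castSucc := fun hk =>
      hk.2.not_gt (Fin.castSucc_lt_castSucc_iff.mpr hj.1)
    exact ((isElementary_of_relPos_upper hl.1 hVW).eq _ hout).trans (ih hWV' hl.2 hj.2)

/-- The sum of the entries `a_p` over the positions `p` of the list which lie in `S`. -/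
def listWeight (A : Matrix (Fin n) (Fin n) ℕ) (S : Finset (Fin n × Fin n))
    (l : List (OffDiag n)) : ℕ :=
  (l.map fun p => if p.1 ∈ S then A p.1.1 p.1.2 else 0).sum

theorem listWeight_cons (S : Finset (Fin n × Fin n)) (p : OffDiag n) (l : List (OffDiag n)) :
    listWeight A S (p :: l) = (if p.1 ∈ S then A p.1.1 p.1.2 else 0) + listWeight A S l := by
  rw [listWeight, List.map_cons, List.sum_cons, listWeight]

theorem listWeight_product_le (R S : Finset (Fin n)) (hl : l.Nodup) :
    listWeight A (R ×ˢ S) l ≤ ∑ r ∈ R, ∑ s ∈ S, A r s := by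
  classical
  rw [← Finset.sum_product' R S A, listWeight, ← List.sum_toFinset _ hl, ← Finset.sum_filter,
    ← Finset.sum_image (s := l.toFinset.filter fun p => p.1 ∈ R ×ˢ S) (g := Subtype.val)
      (f := fun x : Fin n × Fin n => A x.1 x.2) Subtype.val_injective.injOn]
  refine Finset.sum_le_sum_of_subset fun x hx => ?_
  obtain ⟨p, hp, rfl⟩ := Finset.mem_image.mp hx
  exact (Finset.mem_filter.mp hp).2

theorem finrank_eq_meetDim {k l : Fin (n + 1)} (hkl : k ≤ l) (h : V.space l = V'.space l) :
    finrank K (V.space k) = meetDim V V' k l := by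
  rw [meetDim, ← h, inf_eq_left.mpr (V.mono hkl)]

theorem finrank_inf_add_le {E : Type*} [AddCommGroup E] [Module K E] [FiniteDimensional K E]
    {R S : Submodule K E} (h : R ≤ S) (T : Submodule K E) :
    finrank K ↥(S ⊓ T) + finrank K R ≤ finrank K ↥(R ⊓ T) + finrank K S := by
  have hdim := Submodule.finrank_sup_add_finrank_inf_eq R (S ⊓ T)
  rw [← inf_assoc, inf_eq_left.mpr h] at hdim
  have hsup : finrank K ↥(R ⊔ S ⊓ T) ≤ finrank K S :=
    Submodule.finrank_mono (sup_le h inf_le_left)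
  omega

theorem IsGallery.finrank_le_of_upper (h : IsGallery (elemMatrices A D l) V V')
    (hl : ∀ p ∈ l, p.1.1 < p.1.2) (hsort : l.Pairwise fun p p' => p'.1.2 ≤ p.1.2) (hij : i < j) :
    finrank K (V.space i.succ) ≤ meetDim V V' i.succ j.castSucc +
      listWeight A (Finset.Iic i ×ˢ Finset.Ici j) l := by
  have hle : i.succ ≤ j.castSucc :=
    Fin.castSucc_lt_iff_succ_le.mp (Fin.castSucc_lt_castSucc_iff.mpr hij)
  induction l generalizing V with
  | nil =>
    obtain rfl : V = V' := h
    exact (finrank_eq_meetDim hle rfl).trans_le (Nat.le_add_right _ _)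
  | cons p l ih =>
    rw [List.pairwise_cons] at hsort
    obtain hp | hp := lt_or_ge p.1.2 j
    · refine (finrank_eq_meetDim hle (h.space_eq_of_upper hl ?_)).trans_le (Nat.le_add_right _ _)
      exact List.forall_mem_cons.mpr ⟨hp, fun p' hp' => (hsort.1 p' hp').trans_lt hp⟩
    · obtain ⟨W, hVW, hWV'⟩ := h
      rw [List.forall_mem_cons] at hl
      have hstep := isElementary_of_relPos_upper hl.1 hVW
      have hdim := hstep.finrank_le i.succ
      have hmeet : meetDim W V' i.succ j.castSucc ≤ meetDim V V' i.succ j.castSucc :=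
        Submodule.finrank_mono (inf_le_inf_right _ (hstep.le _))
      have hmem : i.succ ∈ Set.Ioc p.1.1.castSucc p.1.2.castSucc →
          p.1 ∈ Finset.Iic i ×ˢ Finset.Ici j := fun hk => by
        rw [Finset.mem_product, Finset.mem_Iic, Finset.mem_Ici]
        exact ⟨Fin.castSucc_lt_succ_iff.mp hk.1, hp⟩
      have hrest := ih hWV' hl.2 hsort.2
      rw [listWeight_cons]
      split_ifs at hdim ⊢ <;> grind

theorem IsGallery.finrank_le_of_lower (h : IsGallery (elemMatrices A D l) V V')
    (hl : ∀ p ∈ l, p.1.2 < p.1.1) (hsort : l.Pairwise fun p p' => p.1.2 ≤ p'.1.2) (hij : j < i) :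
    finrank K (V'.space j.succ) ≤ meetDim V V' i.castSucc j.succ +
      listWeight A (Finset.Ici i ×ˢ Finset.Iic j) l := by
  have hle : j.succ ≤ i.castSucc :=
    Fin.castSucc_lt_iff_succ_le.mp (Fin.castSucc_lt_castSucc_iff.mpr hij)
  induction l generalizing V with
  | nil =>
    obtain rfl : V = V' := h
    rw [meetDim_comm, ← finrank_eq_meetDim hle rfl]
    exact Nat.le_add_right _ _
  | cons p l ih =>
    rw [List.pairwise_cons] at hsort
    obtain hp | hp := lt_or_ge j p.1.2
    · have heq := h.space_eq_of_lower hl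
        (List.forall_mem_cons.mpr ⟨hp, fun p' hp' => hp.trans_le (hsort.1 p' hp')⟩)
      rw [meetDim, ← heq, inf_eq_right.mpr (V.mono hle)]
      exact Nat.le_add_right _ _
    · obtain ⟨W, hVW, hWV'⟩ := h
      rw [List.forall_mem_cons] at hl
      have hstep := isElementary_of_relPos_lower hl.1 hVW
      have hdim := hstep.finrank_le i.castSucc
      have hmeet : meetDim W V' i.castSucc j.succ + finrank K (V.space i.castSucc) ≤
          meetDim V V' i.castSucc j.succ + finrank K (W.space i.castSucc) :=
        finrank_inf_add_le (hstep.le _) _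
      have hmem : i.castSucc ∈ Set.Ioc p.1.2.castSucc p.1.1.castSucc →
          p.1 ∈ Finset.Ici i ×ˢ Finset.Iic j := fun hk => by
        rw [Finset.mem_product, Finset.mem_Iic, Finset.mem_Ici]
        exact ⟨Fin.castSucc_le_castSucc_iff.mp hk.2, hp⟩
      have hrest := ih hWV' hl.2 hsort.2
      rw [listWeight_cons]
      split_ifs at hdim ⊢ <;> grind

theorem IsGallery.preceq_relPos (h : IsGallery (elemMatrices A D (l ++ l')) V V')
    (hl : ∀ p ∈ l, p.1.2 < p.1.1) (hl' : ∀ p ∈ l', p.1.1 < p.1.2)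
    (hsort : l.Pairwise fun p p' => p.1.2 ≤ p'.1.2)
    (hsort' : l'.Pairwise fun p p' => p'.1.2 ≤ p.1.2) (hnodup : l.Nodup) (hnodup' : l'.Nodup) :
    Preceq (relPos V V') A := by
  rw [elemMatrices, List.map_append, isGallery_append] at h
  obtain ⟨W, hVW, hWV'⟩ := h
  refine ⟨fun i j hij => ?_, fun i j hij => ?_⟩
  · have hsum := sum_Iic_Ici_add_corner (relPos V V') i j
    rw [← finrank_left, ← meetDim_eq_corner] at hsum
    have hbound := hWV'.finrank_le_of_upper hl' hsort' hij
    have hweight := listWeight_product_le (A := A) (Finset.Iic i) (Finset.Ici j) hnodup'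
    have hmeet : meetDim W V' i.succ j.castSucc + finrank K (V.space i.succ) ≤
        meetDim V V' i.succ j.castSucc + finrank K (W.space i.succ) :=
      finrank_inf_add_le (hVW.le_of_lower hl i.succ) _
    omega
  · have hsum := sum_Ici_Iic_add_corner (relPos V V') i j
    rw [← finrank_right, ← meetDim_eq_corner] at hsum
    have hbound := hVW.finrank_le_of_lower hl hsort hij
    have hweight := listWeight_product_le (A := A) (Finset.Ici i) (Finset.Iic j) hnodup
    have hmeet : meetDim W V j.succ i.castSucc + finrank K (V'.space j.succ) ≤
        meetDim V' V j.succ i.castSucc + finrank K (W.space j.succ) :=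
      finrank_inf_add_le (hWV'.le_of_upper hl' j.succ) _
    rw [meetDim_comm W V, meetDim_comm V' V] at hmeet
    omega

end Gallery

/-! ### The positions in order -/

section Lists

variable {n : ℕ} {p : OffDiag n}

theorem mem_lowerList : p ∈ lowerList n ↔ p.1.2 < p.1.1 := by
  simp only [lowerList, List.mem_flatMap, List.mem_finRange, true_and, List.mem_filterMap]
  grind

theorem mem_upperList : p ∈ upperList n ↔ p.1.1 < p.1.2 := by
  simp only [upperList, List.mem_flatMap, List.mem_reverse, List.mem_finRange, true_and,
    List.mem_filterMap]
  grind

theorem lowerList_pairwise : (lowerList n).Pairwise fun p p' =>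
    p.1.2 < p'.1.2 ∨ p.1.2 = p'.1.2 ∧ p.1.1 < p'.1.1 := by
  simp only [lowerList, List.pairwise_flatMap, List.pairwise_filterMap, List.mem_filterMap]
  exact ⟨fun j _ => (List.pairwise_lt_finRange n).imp fun _ => by grind,
    (List.pairwise_lt_finRange n).imp fun _ => by grind⟩

theorem upperList_pairwise : (upperList n).Pairwise fun p p' =>
    p'.1.2 < p.1.2 ∨ p.1.2 = p'.1.2 ∧ p'.1.1 < p.1.1 := by
  have hgt := List.pairwise_reverse.mpr (List.pairwise_lt_finRange n)
  simp only [upperList, List.pairwise_flatMap, List.pairwise_filterMap, List.mem_filterMap]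
  exact ⟨fun j _ => hgt.imp fun _ => by grind, hgt.imp fun _ => by grind⟩

theorem lowerList_sorted : (lowerList n).Pairwise fun p p' => p.1.2 ≤ p'.1.2 :=
  lowerList_pairwise.imp fun h => h.elim le_of_lt fun h => h.1.le

theorem upperList_sorted : (upperList n).Pairwise fun p p' => p'.1.2 ≤ p.1.2 :=
  upperList_pairwise.imp fun h => h.elim le_of_lt fun h => h.1.ge

theorem lowerList_nodup : (lowerList n).Nodup :=
  lowerList_pairwise.imp fun h => by
    rintro rfl
    exact h.elim (lt_irrefl _) fun h => lt_irrefl _ h.2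

theorem upperList_nodup : (upperList n).Nodup :=
  upperList_pairwise.imp fun h => by
    rintro rfl
    exact h.elim (lt_irrefl _) fun h => lt_irrefl _ h.2

/-- All off-diagonal positions, in the order of the factors of the product in the theorem. -/
def offDiagList (n : ℕ) : List (OffDiag n) :=
  lowerList n ++ upperList n

theorem mem_offDiagList (p : OffDiag n) : p ∈ offDiagList n := by
  rw [offDiagList, List.mem_append, mem_lowerList, mem_upperList]
  exact lt_or_gt_of_ne p.2.symm

theorem offDiagList_nodup : (offDiagList n).Nodup :=
  List.Nodup.append lowerList_nodup upperList_nodup fun _ h h' =>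
    lt_asymm (mem_lowerList.mp h) (mem_upperList.mp h')

variable {K : Type} [Field K] {d : ℕ} {V V' : Flag K n d} {A : Matrix (Fin n) (Fin n) ℕ}
  {D : OffDiag n → Fin n → ℕ}

theorem IsGallery.preceq (h : IsGallery (elemMatrices A D (offDiagList n)) V V') :
    Preceq (relPos V V') A :=
  h.preceq_relPos (fun _ => mem_lowerList.mp) (fun _ => mem_upperList.mp) lowerList_sorted
    upperList_sorted lowerList_nodup upperList_nodup

end Lists

/-! ### A gallery of coordinate flags -/

section Labels

variable {n : ℕ}

theorem countMatrix_eq_diagonal_add_single {ι : Type*} [Fintype ι] {f g : ι → Fin n}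
    {i j : Fin n} (hij : i ≠ j) (h : ∀ x, f x = g x ∨ (f x = i ∧ g x = j)) :
    countMatrix f g =
      Matrix.diagonal (fun t => countMatrix f g t t) + Matrix.single i j (countMatrix f g i j) := by
  ext r s
  obtain rfl | hrs := eq_or_ne r s
  · rw [Matrix.add_apply, Matrix.diagonal_apply_eq, Matrix.single_apply,
      if_neg fun h => hij (h.1.trans h.2.symm), add_zero]
  · rw [diagonal_add_single_offDiag _ hrs]
    exact (forall_label_and_countMatrix_iff hij).mp ⟨h, rfl⟩ r s hrs

variable {A : Matrix (Fin n) (Fin n) ℕ} {S : Set (Fin n × Fin n)}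

open Classical in
/-- The label of a unit of `A` after the units over the positions in `S` have been moved from
their row label to their column label. The corresponding coordinate flags join the two flags of
a pair of relative position `A` as `S` grows. -/
def label (S : Set (Fin n × Fin n)) (x : Cells A) : Fin n :=
  if x.1 ∈ S then x.1.2 else x.1.1

theorem label_insert_of_ne {p : Fin n × Fin n} {x : Cells A} (hx : x.1 ≠ p) :
    label (insert p S) x = label S x := by
  by_cases hS : x.1 ∈ S <;> simp [label, hx, hS]

theorem label_insert_of_eq {p : Fin n × Fin n} (hp : p ∉ S) {x : Cells A} (hx : x.1 = p) :
    label S x = p.1 ∧ label (insert p S) x = p.2 := by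
  simp [label, hx, hp]

theorem countMatrix_label_insert {p : OffDiag n} (hp : p.1 ∉ S) :
    countMatrix (label S : Cells A → Fin n) (label (insert p.1 S)) =
      elemMatrix A
        (fun t => countMatrix (label S : Cells A → Fin n) (label (insert p.1 S)) t t) p := by
  have hmoved : ∀ x : Cells A,
      label S x = p.1.1 ∧ label (insert p.1 S) x = p.1.2 ↔ x.1.1 = p.1.1 ∧ x.1.2 = p.1.2 := by
    intro x
    rw [← Prod.ext_iff]
    refine ⟨fun h => ?_, label_insert_of_eq hp⟩
    by_contra hx
    rw [label_insert_of_ne hx] at h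
    exact p.2 (h.1.symm.trans h.2)
  have hentry : countMatrix (label S : Cells A → Fin n) (label (insert p.1 S)) p.1.1 p.1.2 =
      A p.1.1 p.1.2 := by
    conv_rhs => rw [← countMatrix_cells A]
    simp only [countMatrix_apply, hmoved]
  rw [elemMatrix, ← hentry]
  refine countMatrix_eq_diagonal_add_single p.2 fun x => ?_
  obtain hx | hx := eq_or_ne x.1 p.1
  · exact Or.inr (label_insert_of_eq hp hx)
  · exact Or.inl (label_insert_of_ne hx).symm

variable {d : ℕ}

theorem exists_isGallery_label {l : List (OffDiag n)} (hl : l.Nodup)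
    (hS : ∀ p ∈ l, p.1 ∉ S) :
    ∃ D : OffDiag n → Fin n → ℕ, ∀ (K : Type) [Field K] (b : Basis (Cells A) K (Fin d → K)),
      IsGallery (elemMatrices A D l) (coordFlag b (label S))
        (coordFlag b (label (S ∪ Subtype.val '' {p | p ∈ l}))) := by
  classical
  induction l generalizing S with
  | nil => exact ⟨0, fun K _ b => by simp [IsGallery, elemMatrices]⟩
  | cons p l ih =>
    rw [List.nodup_cons] at hl
    rw [List.forall_mem_cons] at hS
    have hS' : ∀ p' ∈ l, p'.1 ∉ insert p.1 S := fun p' hp' h =>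
      h.elim (fun h => hl.1 (Subtype.ext h ▸ hp')) (hS.2 p' hp')
    obtain ⟨D, hD⟩ := ih hl.2 hS'
    have hset : S ∪ Subtype.val '' {p' | p' ∈ p :: l} =
        insert p.1 S ∪ Subtype.val '' {p' | p' ∈ l} := by
      ext x
      simp only [Set.mem_union, Set.mem_image, Set.mem_ofPred_eq, List.mem_cons,
        Set.mem_insert_iff, or_and_right, exists_or, exists_eq_left, eq_comm (a := x)]
      tauto
    let diag : Fin n → ℕ := fun t =>
      countMatrix (label S : Cells A → Fin n) (label (insert p.1 S)) t t
    refine ⟨Function.update D p diag, fun K _ b => ?_⟩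
    rw [hset]
    refine ⟨coordFlag b (label (insert p.1 S)), ?_, ?_⟩
    · rw [relPos_coordFlag]
      exact (countMatrix_label_insert hS.1).trans
        (congrArg (elemMatrix A · p) (Function.update_self p diag D).symm)
    · have hupdate := elemMatrices_congr (A := A) fun p' hp' =>
        (Function.update_of_ne (ne_of_mem_of_not_mem hp' hl.1) diag D).symm
      have hgallery := hD K b
      rw [hupdate] at hgallery
      exact hgallery

theorem exists_isGallery (hA : A ∈ Theta n d) :
    ∃ D : OffDiag n → Fin n → ℕ, ∀ (K : Type) [Field K], ∃ V V' : Flag K n d,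
      relPos V V' = A ∧ IsGallery (elemMatrices A D (offDiagList n)) V V' := by
  obtain ⟨D, hD⟩ := exists_isGallery_label (A := A) (d := d) offDiagList_nodup
    (fun p _ => Set.notMem_empty p.1)
  have hfirst : (label ∅ : Cells A → Fin n) = fun x => x.1.1 := by
    ext x
    simp [label]
  have hlast : (label (∅ ∪ Subtype.val '' {p | p ∈ offDiagList n}) : Cells A → Fin n) =
      fun x => x.1.2 := by
    funext x
    by_cases hx : x.1.1 = x.1.2
    · simp only [label, hx, ite_self]
    · exact if_pos (Or.inr ⟨⟨x.1, hx⟩, mem_offDiagList _, rfl⟩)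
  refine ⟨D, fun K _ => ?_⟩
  obtain ⟨b⟩ := nonempty_basis_cells K hA
  refine ⟨_, _, ?_, hD K b⟩
  rw [relPos_coordFlag, hfirst, hlast, countMatrix_cells]

end Labels

/-! ### The leading term of the product -/

section Specialization

open Polynomial

theorem OddField.sqrtQ_sq (κ : OddField) : (κ.sqrtQ : ℝ) ^ 2 = κ.q := by
  rw [OddField.sqrtQ, Units.val_mk0, Real.sq_sqrt (by positivity), OddField.q, Nat.cast_pow]

/-- The Laurent polynomial `f(v²)`, which specializes to `f(q)`. -/
def evalSq (f : ℤ[X]) : LaurentA :=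
  eval₂ LaurentPolynomial.C (LaurentPolynomial.T 2) f

theorem OddField.spec_evalSq (κ : OddField) (f : ℤ[X]) :
    κ.spec (evalSq f) = ((f.eval (κ.q : ℤ) : ℤ) : ℝ) := by
  have hT : κ.spec (LaurentPolynomial.T 2) = κ.q := by
    rw [← κ.sqrtQ_sq]
    exact LaurentPolynomial.eval₂_T_n _ _ 2
  rw [evalSq, hom_eval₂, hT,
    RingHom.ext_int (κ.spec.comp LaurentPolynomial.C) (Int.castRingHom ℝ)]
  exact eval₂_hom (Int.castRingHom ℝ) (κ.q : ℤ)

theorem OddField.infinite_range_sqrtQ :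
    (Set.range fun κ : OddField => (κ.sqrtQ : ℝ)).Infinite := by
  refine fun hfin => OddField.infinite_range_q
    (((hfin.image (· ^ 2)).preimage (Nat.cast_injective (R := ℝ)).injOn).subset ?_)
  rintro _ ⟨κ, rfl⟩
  exact ⟨_, ⟨κ, rfl⟩, κ.sqrtQ_sq⟩

theorem exists_spec_ne_zero {χ : LaurentA} (hχ : χ ≠ 0) : ∃ κ : OddField, κ.spec χ ≠ 0 := by
  by_contra! hspec
  obtain ⟨m, f, hf⟩ := LaurentPolynomial.exists_T_pow χ
  have hf0 : f ≠ 0 := by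
    rintro rfl
    rw [map_zero, eq_comm] at hf
    exact hχ ((LaurentPolynomial.isUnit_T _).mul_left_eq_zero.mp hf)
  have hmap : f.map (Int.castRingHom ℝ) = 0 := by
    refine eq_of_infinite_eval_eq _ _ (OddField.infinite_range_sqrtQ.mono ?_)
    rintro _ ⟨κ, rfl⟩
    have hκ := congrArg κ.spec hf
    rw [map_mul, hspec, zero_mul, OddField.spec, LaurentPolynomial.eval₂_toLaurent] at hκ
    rw [Set.mem_ofPred_eq, eval_zero, eval_map, hκ]
  exact hf0 ((Polynomial.map_eq_zero_iff Int.cast_injective).mp hmap)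

end Specialization

section Support

variable {n d : ℕ} {L : List (Matrix (Fin n) (Fin n) ℕ)} {κ : OddField} {V V' : Flag κ.K n d}

theorem orbitFun_apply_nonneg (C : Matrix (Fin n) (Fin n) ℕ) (V V' : Flag κ.K n d) :
    0 ≤ orbitFun n d C κ V V' := by
  simp only [orbitFun, Matrix.of_apply]
  split_ifs <;> norm_num

theorem orbitFun_apply_ne_zero_iff {C : Matrix (Fin n) (Fin n) ℕ} :
    orbitFun n d C κ V V' ≠ 0 ↔ relPos V V' = C := by
  simp [orbitFun]

theorem prod_orbitFun_apply_nonneg (L : List (Matrix (Fin n) (Fin n) ℕ)) (V V' : Flag κ.K n d) :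
    0 ≤ (L.map (orbitFun n d)).prod κ V V' := by
  induction L generalizing V with
  | nil =>
    change 0 ≤ (1 : Matrix (Flag κ.K n d) (Flag κ.K n d) ℝ) V V'
    rw [Matrix.one_apply]
    split_ifs <;> norm_num
  | cons C L ih =>
    rw [List.map_cons, List.prod_cons, ConvFamily.mul_apply]
    exact Finset.sum_nonneg fun W _ => mul_nonneg (orbitFun_apply_nonneg C V W) (ih W)

theorem prod_orbitFun_apply_ne_zero_iff :
    (L.map (orbitFun n d)).prod κ V V' ≠ 0 ↔ IsGallery L V V' := by
  induction L generalizing V with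
  | nil =>
    change (1 : Matrix (Flag κ.K n d) (Flag κ.K n d) ℝ) V V' ≠ 0 ↔ V = V'
    simp [Matrix.one_apply]
  | cons C L ih =>
    rw [List.map_cons, List.prod_cons, ConvFamily.mul_apply, ne_eq,
      Finset.sum_eq_zero_iff_of_nonneg fun W _ =>
        mul_nonneg (orbitFun_apply_nonneg C V W) (prod_orbitFun_apply_nonneg L W V'), IsGallery]
    push Not
    refine exists_congr fun W => ?_
    rw [mul_ne_zero_iff, ih, orbitFun_apply_ne_zero_iff, and_iff_right (Finset.mem_univ W)]

variable (A : Matrix (Fin n) (Fin n) ℕ) (D : OffDiag n → Fin n → ℕ) {l : List (OffDiag n)}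
  {F : ConvFamily n d}

theorem IsPolynomial.mul_prod_orbitFun (hF : IsPolynomial F) (hl : ∀ p ∈ l, p.1.1 < p.1.2) :
    IsPolynomial (F * ((elemMatrices A D l).map (orbitFun n d)).prod) := by
  induction l generalizing F with
  | nil => exact (mul_one F).symm ▸ hF
  | cons p l ih =>
    rw [List.forall_mem_cons] at hl
    rw [elemMatrices, List.map_cons, List.map_cons, List.prod_cons, ← mul_assoc]
    exact ih (hF.mul_orbitFun hl.1 _ _) hl.2

theorem IsPolynomial.prod_orbitFun_mul (hF : IsPolynomial F) (hl : ∀ p ∈ l, p.1.2 < p.1.1) :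
    IsPolynomial (((elemMatrices A D l).map (orbitFun n d)).prod * F) := by
  induction l with
  | nil => exact (one_mul F).symm ▸ hF
  | cons p l ih =>
    rw [List.forall_mem_cons] at hl
    rw [elemMatrices, List.map_cons, List.map_cons, List.prod_cons, mul_assoc]
    exact (ih hl.2).orbitFun_mul hl.1 _ _

/-- The product of the `e_{D_p + a_p E_p}` over all positions `p`, in the order of the theorem. -/
def elemProd (d : ℕ) : schurAlgebra n d :=
  ((lowerList n).map fun p => e n d (elemMatrix A (D p) p)).prod *
    ((upperList n).map fun p => e n d (elemMatrix A (D p) p)).prod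

theorem coe_elemProd : (elemProd A D d : ConvFamily n d) =
    ((elemMatrices A D (offDiagList n)).map (orbitFun n d)).prod := by
  rw [elemProd, ← List.prod_append, ← List.map_append, ← Subalgebra.coe_val, map_list_prod,
    List.map_map, elemMatrices, List.map_map]
  rfl

theorem isPolynomial_elemProd : IsPolynomial (elemProd A D d : ConvFamily n d) := by
  rw [coe_elemProd, offDiagList, elemMatrices, List.map_append, List.map_append, List.prod_append,
    ← one_mul (List.prod (List.map (orbitFun n d) (List.map _ (upperList n))))]
  exact (isPolynomial_one.mul_prod_orbitFun A D fun _ => mem_upperList.mp).prod_orbitFun_mul A D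
    fun _ => mem_lowerList.mp

variable {A D}

theorem elemProd_apply_ne_zero_iff : (elemProd A D d : ConvFamily n d) κ V V' ≠ 0 ↔
    IsGallery (elemMatrices A D (offDiagList n)) V V' := by
  rw [coe_elemProd, prod_orbitFun_apply_ne_zero_iff]

end Support

section LeadingTerm

variable {n d : ℕ} {A : Matrix (Fin n) (Fin n) ℕ} {κ : OddField} {V V' : Flag κ.K n d}

theorem ConvFamily.smul_apply (χ : LaurentA) (F : ConvFamily n d) (κ : OddField)
    (V V' : Flag κ.K n d) : (χ • F) κ V V' = κ.spec χ * F κ V V' := by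
  change (Matrix.scalar (Flag κ.K n d) (κ.spec χ) * F κ) V V' = _
  simp

/-- The value of an element of `𝒮` at a pair of flags over the field `κ`. -/
def evalAt (κ : OddField) (V V' : Flag κ.K n d) : schurAlgebra n d →+ ℝ where
  toFun x := (x : ConvFamily n d) κ V V'
  map_zero' := rfl
  map_add' _ _ := rfl

theorem ext_evalAt {x y : schurAlgebra n d}
    (h : ∀ (κ : OddField) (V V' : Flag κ.K n d), evalAt κ V V' x = evalAt κ V V' y) : x = y :=
  Subtype.ext (ConvFamily.ext h)

open Classical in
theorem evalAt_smul_e (χ : LaurentA) (C : Matrix (Fin n) (Fin n) ℕ) :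
    evalAt κ V V' (χ • e n d C) = if relPos V V' = C then κ.spec χ else 0 := by
  change (χ • orbitFun n d C) κ V V' = _
  rw [ConvFamily.smul_apply, orbitFun, Matrix.of_apply, mul_ite, mul_one, mul_zero]

/-- The combinations of the `e_C` with `C ≺ A`. -/
def lowerTerms (d : ℕ) (A : Matrix (Fin n) (Fin n) ℕ) : Submodule LaurentA (schurAlgebra n d) :=
  Submodule.span LaurentA (e n d '' {C | C ∈ Theta n d ∧ Prec C A})

theorem evalAt_eq_zero_of_mem_lowerTerms {L : schurAlgebra n d} (hL : L ∈ lowerTerms d A)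
    (hV : relPos V V' = A) : evalAt κ V V' L = 0 := by
  induction hL using Submodule.span_induction with
  | mem x hx =>
    obtain ⟨C, ⟨-, hC⟩, rfl⟩ := hx
    rw [← one_smul LaurentA (e n d C), evalAt_smul_e, if_neg]
    rintro rfl
    rw [hV] at hC
    exact hC.2 hC.1
  | zero => exact map_zero _
  | add x y _ _ hx hy => rw [map_add, hx, hy, add_zero]
  | smul χ x _ hx => exact (ConvFamily.smul_apply χ _ κ V V').trans (mul_eq_zero_of_right _ hx)

theorem evalAt_smul_e_add {L : schurAlgebra n d} (hL : L ∈ lowerTerms d A) (χ : LaurentA)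
    (hV : relPos V V' = A) : evalAt κ V V' (χ • e n d A + L) = κ.spec χ := by
  rw [map_add, evalAt_smul_e, if_pos hV, evalAt_eq_zero_of_mem_lowerTerms hL hV, add_zero]

theorem finite_Theta : (Theta n d).Finite := by
  refine (Set.Finite.pi' (t := fun _ : Fin n => {f : Fin n → ℕ | ∀ j, f j ∈ Set.Iic d})
    fun _ => Set.Finite.pi' fun _ => Set.finite_Iic d).subset ?_
  intro C hC i j
  calc C i j ≤ ∑ j, C i j := Finset.single_le_sum (fun _ _ => Nat.zero_le _) (Finset.mem_univ j)
    _ ≤ ∑ i, ∑ j, C i j :=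
      Finset.single_le_sum (f := fun i => ∑ j, C i j) (fun _ _ => Nat.zero_le _) (Finset.mem_univ i)
    _ = d := hC

theorem exists_eq_smul_e_add {x : schurAlgebra n d} (hx : IsPolynomial (x : ConvFamily n d))
    (hsupp : ∀ (κ : OddField) (V V' : Flag κ.K n d), evalAt κ V V' x ≠ 0 →
      relPos V V' = A ∨ Prec (relPos V V') A) :
    ∃ χ : LaurentA, ∃ L ∈ lowerTerms d A, x = χ • e n d A + L := by
  classical
  obtain ⟨c, hc⟩ := hx
  have hfin : {C | C ∈ Theta n d ∧ Prec C A}.Finite := finite_Theta.subset fun C hC => hC.1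
  refine ⟨evalSq (c A), ∑ C ∈ hfin.toFinset, evalSq (c C) • e n d C,
    Submodule.sum_mem _ fun C hC => Submodule.smul_mem _ _ (Submodule.subset_span
      ⟨C, hfin.mem_toFinset.mp hC, rfl⟩), ext_evalAt fun κ V V' => ?_⟩
  have hterm (C : Matrix (Fin n) (Fin n) ℕ) : evalAt κ V V' (evalSq (c C) • e n d C) =
      if relPos V V' = C then evalAt κ V V' x else 0 := by
    rw [evalAt_smul_e, κ.spec_evalSq]
    refine ite_congr rfl (fun h => ?_) fun _ => rfl
    rw [← h]
    exact (hc κ V V').symm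
  rw [map_add, map_sum, hterm, Finset.sum_congr rfl fun C _ => hterm C, Finset.sum_ite_eq]
  by_cases hzero : evalAt κ V V' x = 0
  · simp only [hzero, ite_self, add_zero]
  obtain hV | hV := hsupp κ V V' hzero
  · rw [if_pos hV, if_neg fun h => ?_, add_zero]
    have hlt := (hfin.mem_toFinset.mp h).2
    rw [hV] at hlt
    exact hlt.2 hlt.1
  · rw [if_neg fun h => ?_, if_pos (hfin.mem_toFinset.mpr ⟨relPos_mem_Theta V V', hV⟩), zero_add]
    rw [h] at hV
    exact hV.2 hV.1

end LeadingTerm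

section ElemProd

variable {n d : ℕ} {A : Matrix (Fin n) (Fin n) ℕ} {D D' : OffDiag n → Fin n → ℕ}

theorem finrank_eq_of_isGallery_offDiagList {K : Type} [Field K] {V V' U U' : Flag K n d}
    (h : IsGallery (elemMatrices A D (offDiagList n)) V V')
    (h' : IsGallery (elemMatrices A D (offDiagList n)) U U') (k : Fin (n + 1)) :
    finrank K (V.space k) = finrank K (U.space k) := by
  obtain hempty | hempty := isEmpty_or_nonempty (OffDiag n)
  · have : Subsingleton (Fin n) := ⟨fun i j => by_contra fun hij => hempty.false ⟨(i, j), hij⟩⟩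
    have hn : n ≤ 1 := Fin.subsingleton_iff_le_one.mp this
    obtain rfl | rfl : k = 0 ∨ k = Fin.last n := by
      rw [Fin.ext_iff, Fin.ext_iff, Fin.val_zero, Fin.val_last]
      lia
    · rw [V.first, U.first]
    · rw [V.last, U.last]
  · obtain ⟨p⟩ := hempty
    exact h.finrank_eq h' (List.ne_nil_of_mem (List.mem_map_of_mem (mem_offDiagList p))) k

theorem relPos_eq_or_prec {K : Type} [Field K] {V V' U U' : Flag K n d} (hU : relPos U U' = A)
    (hgallery : IsGallery (elemMatrices A D (offDiagList n)) U U')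
    (h : IsGallery (elemMatrices A D (offDiagList n)) V V') :
    relPos V V' = A ∨ Prec (relPos V V') A := by
  refine or_iff_not_imp_left.mpr fun hne => ⟨h.preceq, fun hge => hne ?_⟩
  refine eq_of_preceq_preceq h.preceq hge fun k => ?_
  rw [← hU, ← finrank_left, ← finrank_left, finrank_eq_of_isGallery_offDiagList h hgallery]

/-- The element `x` of `𝒮` equals `χ e_A` plus lower terms, for some `χ ≠ 0`. -/
def HasLeadingTerm (d : ℕ) (A : Matrix (Fin n) (Fin n) ℕ) (x : schurAlgebra n d) : Prop :=
  ∃ χ : LaurentA, χ ≠ 0 ∧ ∃ L ∈ lowerTerms d A, x = χ • e n d A + L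

theorem hasLeadingTerm_elemProd
    (h : ∀ (K : Type) [Field K], ∃ V V' : Flag K n d,
      relPos V V' = A ∧ IsGallery (elemMatrices A D (offDiagList n)) V V') :
    HasLeadingTerm d A (elemProd A D d) := by
  obtain ⟨χ, L, hL, hx⟩ := exists_eq_smul_e_add (isPolynomial_elemProd A D)
    fun κ V V' hV => by
      obtain ⟨U, U', hU, hgallery⟩ := h κ.K
      exact relPos_eq_or_prec hU hgallery (elemProd_apply_ne_zero_iff.mp hV)
  refine ⟨χ, ?_, L, hL, hx⟩
  rintro rfl
  obtain ⟨_, κ, _⟩ := OddField.infinite_range_q.nonempty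
  obtain ⟨V, V', hV, hgallery⟩ := h κ.K
  refine elemProd_apply_ne_zero_iff.mpr hgallery ?_
  rw [hx]
  exact (evalAt_smul_e_add hL 0 hV).trans (map_zero _)

theorem HasLeadingTerm.eq_of_isGallery (h : HasLeadingTerm d A (elemProd A D' d))
    (hD : ∀ (K : Type) [Field K], ∃ V V' : Flag K n d,
      relPos V V' = A ∧ IsGallery (elemMatrices A D (offDiagList n)) V V') : D' = D := by
  obtain ⟨χ, hχ, L, hL, hx⟩ := h
  obtain ⟨κ, hκ⟩ := exists_spec_ne_zero hχ
  obtain ⟨V, V', hV, hgallery⟩ := hD κ.K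
  have hgallery' : IsGallery (elemMatrices A D' (offDiagList n)) V V' := by
    rw [← elemProd_apply_ne_zero_iff, hx]
    exact (evalAt_smul_e_add hL χ hV).trans_ne hκ
  exact funext fun p => hgallery'.diag_eq hgallery (fun _ => rfl) p (mem_offDiagList p)

end ElemProd

end BLM

end

theorem mainTheorem4 (n d : ℕ) (hn : 0 < n) (hd : 0 < d)
    (A : Matrix (Fin n) (Fin n) ℕ) (hA : A ∈ BLM.Theta n d) :
    ∃! D : BLM.OffDiag n → Fin n → ℕ,
      (∀ p, BLM.elemMatrix A (D p) p ∈ BLM.Theta n d) ∧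
      ∃ χ : BLM.LaurentA, χ ≠ 0 ∧
        ∃ L ∈ Submodule.span BLM.LaurentA
            (BLM.e n d '' {C | C ∈ BLM.Theta n d ∧ BLM.Prec C A}),
          ((BLM.lowerList n).map fun p => BLM.e n d (BLM.elemMatrix A (D p) p)).prod *
            ((BLM.upperList n).map fun p => BLM.e n d (BLM.elemMatrix A (D p) p)).prod =
          χ • BLM.e n d A + L := by
  obtain ⟨D, hD⟩ := BLM.exists_isGallery hA
  refine ⟨D, ⟨fun p => ?_, BLM.hasLeadingTerm_elemProd hD⟩,
    fun D' hD' => BLM.HasLeadingTerm.eq_of_isGallery hD'.2 hD⟩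
  obtain ⟨V, V', -, hgallery⟩ := hD ℚ
  exact hgallery.mem_Theta (List.mem_map_of_mem (BLM.mem_offDiagList p))
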